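/- All groups are finite and all characters are complex characters of nonzero finite-dimensional representations; $\mathrm{Irr}(G)$ is the set of irreducible characters of $G$. A supercharacter theory of a finite group $G$ is a pair $(\mathcal K,\mathcal X)$, where $\mathcal K$ is a partition of $G$ into unions of conjugacy classes (the superclasses) and $\mathcal X$ is a set of characters of $G$ (the supercharacters), such that $|\mathcal X|=|\mathcal K|$, every $\chi\in\mathcal X$ is constant on each block of $\mathcal K$, and every irreducible character of $G$ is a constituent of exactly one $\chi\in\mathcal X$. A superclass function is a function $G\to\mathbb C$ that is constant on the blocks of $\mathcal K$. We write ${}^hx=hxh^{-1}$, $K^h=h^{-1}Kh$, and $\alpha^h(x)=\alpha({}^hx)$ for a function $\alpha$. Let $G=N\rtimes H$ be a finite group with $N$ abelian. For $\psi\in\mathrm{Irr}(N)$ let $I_H(\psi)=\{h\in H:\psi^h=\psi\}$. For a subgroup $K\le I_H(\psi)$ and a character $\chi$ of $K$ put $\psi\rtimes\chi=\operatorname{Ind}_{NK}^{G}(\alpha)$, where $\alpha(nk)=\psi(n)\chi(k)$ for $n\in N$, $k\in K$. Let $\mathcal L$ be a sublattice of the lattice of subgroups of $H$ such that (L1) $H\in\mathcal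 L$ and $\{1\}\in\mathcal L$; (L2) if $K\in\mathcal L$ and $h\in H$, then $hKh^{-1}\in\mathcal L$; (L3) each $K\in\mathcal L$ is equipped with a supercharacter theory; (L4) for $K\le M$ in $\mathcal L$, $\operatorname{Ind}_K^M$ and $\operatorname{Res}_K^M$ send superclass functions to superclass functions; and if $\chi$ is a supercharacter of $K\in\mathcal L$ and $h\in H$, then $\chi^h$ is a supercharacter of $K^h$. For each $\psi\in\mathrm{Irr}(N)$ let $H_\psi\in\mathcal L$ be chosen such that (H1) $H_\psi$ is a normal subgroup of $I_H(\psi)$; (H2) $H_{(\psi^h)}=(H_\psi)^h$ for all $h\in H$; (H3) $H_{1_N}=H$, where $1_N$ is the trivial character of $N$; (H4) $H_\psi\cap H_\varphi\subseteq H_{\psi\varphi}$ for all $\psi,\varphi\in\mathrm{Irr}(N)$. Let $S$ be a set of representatives of the orbits of $\mathrm{Irr}(N)$ under the conjugation action of $G$. Then the set $$\mathrm{SCh}(\mathcal L)=\bigl\{\psi\rtimes\operatorname{Ind}_{H_\psi}^{I_H(\psi)}\chi \;:\; \psi\in S,\ \chi\text{ a supercharacter of }H_\psi\bigr\}$$ is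 the set of supercharacters of a supercharacter theory of $G$. -/

import Mathlib

namespace Supercharacter

noncomputable section

/-! ### Characters of a finite group -/

/-- `f` is a (complex, nonzero) character of `G`: the trace function of a representation of `G` on
`ℂⁿ` with `n ≠ 0`. -/
def IsCharacter {G : Type*} [Group G] (f : G → ℂ) : Prop :=
  ∃ (n : ℕ) (ρ : Representation ℂ G (Fin n → ℂ)), n ≠ 0 ∧ ρ.character = f

/-- `Irr(G)`: the set of characters of irreducible finite-dimensional complex representations. -/
def irr (G : Type*) [Group G] : Set (G → ℂ) :=
  {f | ∃ (n : ℕ) (ρ : Representation ℂ G (Fin n → ℂ)), ρ.IsIrreducible ∧ ρ.character = f}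

/-- The usual inner product `⟨f, g⟩ = |G|⁻¹ ∑ₓ f(x) conj(g(x))` on complex functions on `G`. -/
def charInner {G : Type*} [Group G] (f g : G → ℂ) : ℂ :=
  (Nat.card G : ℂ)⁻¹ * ∑ᶠ x : G, f x * (starRingEnd ℂ) (g x)

/-- The irreducible character `ψ` is a constituent of the character `χ`: it occurs in `χ` with
nonzero multiplicity `⟨χ, ψ⟩`. -/
def IsConstituent {G : Type*} [Group G] (ψ χ : G → ℂ) : Prop :=
  charInner χ ψ ≠ 0

open Classical in
/-- The induced function `Ind_K^G f`, given by
`(Ind_K^G f)(g) = |K|⁻¹ ∑ f(x g x⁻¹)`, the sum over the `x ∈ G` with `x g x⁻¹ ∈ K`. -/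
def ind {G : Type*} [Group G] (K : Subgroup G) (f : K → ℂ) : G → ℂ := fun g =>
  (Nat.card K : ℂ)⁻¹ * ∑ᶠ x : G, if hx : x * g * x⁻¹ ∈ K then f ⟨x * g * x⁻¹, hx⟩ else 0

/-- `Ind_K^M f` for two subgroups `K ≤ M` of a common group: `K` is viewed as a subgroup of `M`. -/
def indTo {H : Type*} [Group H] (K M : Subgroup H) (f : K → ℂ) : M → ℂ :=
  ind (K.subgroupOf M) (fun x => f ⟨(x : M), Subgroup.mem_subgroupOf.1 x.2⟩)

/-! ### Supercharacter theories -/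

/-- A supercharacter theory of `G`: a partition `superclasses` of `G` into unions of conjugacy
classes, and a set `supercharacters` of characters of `G`, with (SCT1)--(SCT3). -/
structure SupercharacterTheory (G : Type*) [Group G] where
  /-- The blocks of the partition. -/
  superclasses : Set (Set G)
  /-- The supercharacters. -/
  supercharacters : Set (G → ℂ)
  isPartition : Setoid.IsPartition superclasses
  conj_mem : ∀ C ∈ superclasses, ∀ x ∈ C, ∀ g : G, g * x * g⁻¹ ∈ C
  isCharacter : ∀ χ ∈ supercharacters, IsCharacter χ
  /-- (SCT1) -/
  encard_eq : supercharacters.encard = superclasses.encard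
  /-- (SCT2) -/
  constant : ∀ χ ∈ supercharacters, ∀ C ∈ superclasses, ∀ x ∈ C, ∀ y ∈ C, χ x = χ y
  /-- (SCT3) -/
  existsUnique_constituent : ∀ θ ∈ irr G, ∃! χ, χ ∈ supercharacters ∧ IsConstituent θ χ

/-- `f` is a superclass function: it is constant on the superclasses. -/
def SupercharacterTheory.IsSuperclassFunction {G : Type*} [Group G] (T : SupercharacterTheory G)
    (f : G → ℂ) : Prop :=
  ∀ C ∈ T.superclasses, ∀ x ∈ C, ∀ y ∈ C, f x = f y

/-! ### Conjugation of subgroups and of functions on them -/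

/-- `K^h = h⁻¹ K h`. -/
def conjSubgroup {H : Type*} [Group H] (K : Subgroup H) (h : H) : Subgroup H :=
  K.map (MulAut.conj h⁻¹).toMonoidHom

theorem mem_conjSubgroup {H : Type*} [Group H] {K : Subgroup H} {h x : H} :
    x ∈ conjSubgroup K h ↔ h * x * h⁻¹ ∈ K := by
  constructor
  · rintro ⟨y, hy, rfl⟩
    simpa [mul_assoc] using hy
  · intro hx
    exact ⟨h * x * h⁻¹, hx, by simp [mul_assoc]⟩

/-- For a function `χ` on `K`, the function `χ^h` on `K^h` given by `χ^h(x) = χ(h x h⁻¹)`. -/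
def conjFun {H : Type*} [Group H] {K : Subgroup H} (χ : K → ℂ) (h : H) :
    conjSubgroup K h → ℂ :=
  fun x => χ ⟨h * x * h⁻¹, mem_conjSubgroup.1 x.2⟩

/-! ### Semidirect products `G = N ⋊ H` -/

/-- The conjugate `ᵍn = g n g⁻¹` of `n ∈ N` by an element `g` of `G = N ⋊ H`, as an element of the
normal subgroup `N`. -/
def conjN {N H : Type*} [Group N] [Group H] {φ : H →* MulAut N} (g : N ⋊[φ] H) (n : N) : N :=
  (g * SemidirectProduct.inl n * g⁻¹).left

theorem inl_conjN {N H : Type*} [Group N] [Group H] {φ : H →* MulAut N} (g : N ⋊[φ] H) (n : N) :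
    (SemidirectProduct.inl (conjN g n) : N ⋊[φ] H) = g * SemidirectProduct.inl n * g⁻¹ := by
  ext <;> simp [conjN]

theorem conjN_inr {N H : Type*} [Group N] [Group H] {φ : H →* MulAut N} (h : H) (n : N) :
    conjN (SemidirectProduct.inr h : N ⋊[φ] H) n = φ h n := by
  simp [conjN]

/-- For a function `ψ` on `N` and `g ∈ G = N ⋊ H`, the function `ψ^g(n) = ψ(g n g⁻¹)` on `N`. -/
def conjChar {N H : Type*} [Group N] [Group H] {φ : H →* MulAut N} (ψ : N → ℂ) (g : N ⋊[φ] H) :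
    N → ℂ :=
  fun n => ψ (conjN g n)

/-- The inertial subgroup `I_H(ψ) = {h ∈ H | ψ^h = ψ}`. -/
def inertia {N H : Type*} [Group N] [Group H] (φ : H →* MulAut N) (ψ : N → ℂ) : Subgroup H where
  carrier := {h | conjChar ψ (SemidirectProduct.inr h : N ⋊[φ] H) = ψ}
  one_mem' := by
    funext n
    simp [conjChar, conjN]
  mul_mem' := by
    intro a b ha hb
    funext n
    have h1 := congrFun ha (φ b n)
    have h2 := congrFun hb n
    simp only [conjChar, conjN_inr] at h1 h2 ⊢
    rw [map_mul, MulAut.mul_apply, h1, h2]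
  inv_mem' := by
    intro a ha
    funext n
    have h1 := congrFun ha (φ a⁻¹ n)
    simp only [conjChar, conjN_inr] at h1 ⊢
    rw [← h1, ← MulAut.mul_apply, ← map_mul]
    simp

/-- The subgroup `NK` of `G = N ⋊ H`, for `K` a subgroup of `H`: the elements whose `H`-component
lies in `K`. -/
def prodN {N H : Type*} [Group N] [Group H] (φ : H →* MulAut N) (K : Subgroup H) :
    Subgroup (N ⋊[φ] H) :=
  K.comap SemidirectProduct.rightHom

theorem prodN_eq_sup {N H : Type*} [Group N] [Group H] (φ : H →* MulAut N) (K : Subgroup H) :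
    prodN φ K = (SemidirectProduct.inl : N →* N ⋊[φ] H).range ⊔ K.map SemidirectProduct.inr := by
  apply le_antisymm
  · intro x hx
    rw [← SemidirectProduct.inl_left_mul_inr_right x]
    exact Subgroup.mul_mem_sup ⟨_, rfl⟩ ⟨x.right, hx, rfl⟩
  · rw [sup_le_iff]
    constructor
    · rintro _ ⟨n, rfl⟩
      simp [prodN]
    · rintro _ ⟨k, hk, rfl⟩
      simpa [prodN] using hk

/-- The function `ψ ⋊ χ = Ind_{NK}^G (ψ̃ · Inf_K^{NK} χ)` on `G = N ⋊ H`, where `χ` is a function on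
a subgroup `K` of `I_H(ψ)`, `ψ̃(nk) = ψ(n)` and `(Inf χ)(nk) = χ(k)` for `n ∈ N`, `k ∈ K`. -/
def rtimes {N H : Type*} [Group N] [Group H] (φ : H →* MulAut N) (ψ : N → ℂ) {K : Subgroup H}
    (χ : K → ℂ) : N ⋊[φ] H → ℂ :=
  ind (prodN φ K) (fun x => ψ (x : N ⋊[φ] H).left * χ ⟨(x : N ⋊[φ] H).right, x.2⟩)

/-- `S` is a set of representatives for the orbits of `Irr(N)` under conjugation by `G = N ⋊ H`. -/
def IsOrbitReps {N H : Type*} [Group N] [Group H] (φ : H →* MulAut N) (S : Set (N → ℂ)) : Prop :=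
  S ⊆ irr N ∧ ∀ ψ ∈ irr N, ∃! ρ, ρ ∈ S ∧ ∃ g : N ⋊[φ] H, ρ = conjChar ψ g

/-- The set `SCh(ℒ)` of the functions `ψ ⋊ Ind_{H_ψ}^{I_H(ψ)} χ`, for `ψ ∈ S` and `χ` a
supercharacter of `H_ψ`. -/
def SCh {N H : Type*} [Group N] [Group H] (φ : H →* MulAut N) (L : Sublattice (Subgroup H))
    (T : ∀ K : L, SupercharacterTheory (K : Subgroup H)) (Hsub : (N → ℂ) → L)
    (S : Set (N → ℂ)) : Set (N ⋊[φ] H → ℂ) :=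
  {f | ∃ ψ ∈ S, ∃ χ ∈ (T (Hsub ψ)).supercharacters,
    f = rtimes φ ψ (indTo (Hsub ψ : Subgroup H) (inertia φ ψ) χ)}

end

end Supercharacter

/-!
Write `G = N ⋊ H`. A function `ψ ⋊ Ind_{H_ψ}^{I_H(ψ)} χ` is, up to a nonzero constant depending only
on `ψ`, the sum over `g ∈ G` of the conjugates `x ↦ E (g x g⁻¹)` of the elementary function
`E(nh) = ψ(n) χ(h)`, where `χ` is extended by zero from `H_ψ` to `H` (`rtimes_indTo`). Elementary
functions are easily conjugated (`outer_conj`), multiplied and paired (`charInner_outer`), and this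
replaces Clifford theory and Mackey's theorem throughout.

For any finite group, a set `X` of pairwise orthogonal characters is the set of supercharacters of a
supercharacter theory as soon as its span is closed under products and contains `1` and the regular
character (`exists_supercharacterTheory`). Indeed, call two elements equivalent if `X` does not
separate them. By the finite Stone--Weierstrass theorem (`mem_of_separates`) the span is the space
of all functions constant on the classes; comparing dimensions, there are as many classes as
elements of `X`. An irreducible character is a constituent of some element of `X` because it is one
of the regular character, and of only one because characters sharing a constituent are not
orthogonal (`charInner_ne_zero_iff`, a consequence of Maschke's theorem).

The set `SCh(ℒ)` has these properties.

* Its elements are characters, as characters can be induced (`IsCharacter.ind`,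
  `IsCharacter.rtimes`).
* They are orthogonal (`charInner_eq_zero_of_mem_SCh`): if the terms for `(ψ, χ)` and `(ψ', χ')` are
  not orthogonal, some conjugates of the elementary functions are not; then `ψ` and `ψ'` are
  conjugate, hence equal, and `χ` is a conjugate of `χ'` under the inertial subgroup, so the two
  induced functions coincide.
* Their span contains the sum of conjugates of every elementary function built from `ψ ∈ Irr(N)`
  and a superclass function of some `K ≤ H_ψ` in `ℒ` (`conjSum_outer_mem_span_SCh`): superclass
  functions are spanned by supercharacters (`SupercharacterTheory.span_supercharacters`), and they
  can be induced from `K` to `H_ψ`. Taking `ψ = 1` and `K = H` gives the constant `1`; summing over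
  all `ψ` with `K = 1` gives the regular character. A product of two sums of conjugates is a sum of
  sums of conjugates of products (`conjSum_mul_conjSum`), and a product of elementary functions for
  `(ψ, K)` and `(ψ', K')` is elementary for `(ψψ', K ∩ K')`, where `K ∩ K' ≤ H_ψψ'`.
-/

namespace Supercharacter

open Module

/-! ### Characters and their inner products -/

/-- Transport of a representation along a linear equivalence. -/
def conjRep {G : Type*} [Group G] {V W : Type*} [AddCommGroup V] [Module ℂ V] [AddCommGroup W]
    [Module ℂ W] (e : V ≃ₗ[ℂ] W) (ρ : Representation ℂ G V) : Representation ℂ G W where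
  toFun g := e.conj (ρ g)
  map_one' := by ext; simp [LinearEquiv.conj_apply]
  map_mul' a b := by ext; simp [LinearEquiv.conj_apply]

theorem character_conjRep {G : Type*} [Group G] {V W : Type*} [AddCommGroup V] [Module ℂ V]
    [AddCommGroup W] [Module ℂ W] (e : V ≃ₗ[ℂ] W) (ρ : Representation ℂ G V) :
    (conjRep e ρ).character = ρ.character := by
  funext g
  exact LinearMap.trace_conj' (ρ g) e

theorem isIrreducible_conjRep {G : Type*} [Group G] {V W : Type*} [AddCommGroup V] [Module ℂ V]
    [AddCommGroup W] [Module ℂ W] (e : V ≃ₗ[ℂ] W) (ρ : Representation ℂ G V)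
    (h : ρ.IsIrreducible) : (conjRep e ρ).IsIrreducible := by
  let F : Subrepresentation (conjRep e ρ) ≃o Subrepresentation ρ :=
    { toFun := fun U => ⟨U.toSubmodule.comap e.toLinearMap, fun g v hv => by
        have := U.apply_mem_toSubmodule g hv
        simpa [conjRep, LinearEquiv.conj_apply] using this⟩
      invFun := fun U => ⟨U.toSubmodule.comap e.symm.toLinearMap, fun g v hv => by
        have := U.apply_mem_toSubmodule g hv
        simpa [conjRep, LinearEquiv.conj_apply] using this⟩
      left_inv := fun U => by
        ext x; simp
      right_inv := fun U => by
        ext x; simp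
      map_rel_iff' := by
        intro U U'
        constructor
        · intro h x hx
          have h1 : e (e.symm x) ∈ U.toSubmodule := by rwa [e.apply_symm_apply]
          have h2 : e (e.symm x) ∈ U'.toSubmodule := @h (e.symm x) h1
          rwa [e.apply_symm_apply] at h2
        · intro h x hx
          exact @h (e x) hx }
  exact F.isSimpleOrder

theorem isCharacter_of_rep {G : Type*} [Group G] {V : Type*} [AddCommGroup V] [Module ℂ V]
    [FiniteDimensional ℂ V] [Nontrivial V] (ρ : Representation ℂ G V) :
    IsCharacter ρ.character :=
  ⟨finrank ℂ V, conjRep (finBasis ℂ V).equivFun ρ, finrank_pos.ne',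
    character_conjRep _ _⟩

theorem mem_irr_of_rep {G : Type*} [Group G] {V : Type*} [AddCommGroup V] [Module ℂ V]
    [FiniteDimensional ℂ V] (ρ : Representation ℂ G V) (h : ρ.IsIrreducible) :
    ρ.character ∈ irr G :=
  ⟨finrank ℂ V, conjRep (finBasis ℂ V).equivFun ρ, isIrreducible_conjRep _ _ h,
    character_conjRep _ _⟩

theorem irr_subset_isCharacter {G : Type*} [Group G] {θ : G → ℂ} (hθ : θ ∈ irr G) :
    IsCharacter θ := by
  obtain ⟨n, ρ, hρ, rfl⟩ := hθ
  refine ⟨n, ρ, ?_, rfl⟩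
  rintro rfl
  obtain ⟨a, b, hab⟩ := hρ.toNontrivial
  refine hab ?_
  ext x
  rw [Subsingleton.elim x 0]
  exact ⟨fun _ => zero_mem b.toSubmodule, fun _ => zero_mem a.toSubmodule⟩

open scoped ComplexOrder in
/-- Every complex character of a finite group satisfies `χ(g⁻¹) = conj χ(g)`: averaging the standard
Hermitian form gives a positive definite form which the representation preserves. -/
theorem character_inv {G : Type*} [Group G] [Finite G] {n : ℕ}
    (ρ : Representation ℂ G (Fin n → ℂ)) (g : G) :
    ρ.character g⁻¹ = (starRingEnd ℂ) (ρ.character g) := by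
  classical
  have := Fintype.ofFinite G
  let M : G → Matrix (Fin n) (Fin n) ℂ := fun g => LinearMap.toMatrix' (ρ g)
  have hM1 : M 1 = 1 := by simp [M]
  have hMmul : ∀ a b, M (a * b) = M a * M b := fun a b => by
    simp [M, LinearMap.toMatrix'_mul]
  have hchar : ∀ g, ρ.character g = (M g).trace := fun g => by
    rw [Representation.character, LinearMap.trace_eq_matrix_trace ℂ (Pi.basisFun ℂ (Fin n))]
    rfl
  let P : Matrix (Fin n) (Fin n) ℂ := ∑ a, (M a).conjTranspose * M a
  have hP : P.PosDef := by
    have h1 : P = (M 1).conjTranspose * M 1 +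
        ∑ a ∈ Finset.univ.erase 1, (M a).conjTranspose * M a :=
      (Finset.add_sum_erase _ _ (Finset.mem_univ 1)).symm
    rw [h1, hM1]
    simp only [Matrix.conjTranspose_one, one_mul]
    exact Matrix.PosDef.one.add_posSemidef
      (Matrix.posSemidef_sum _ fun a _ => Matrix.posSemidef_conjTranspose_mul_self _)
  have hinv : (M g).conjTranspose * P = P * M g⁻¹ := by
    simp only [P, Finset.mul_sum, Finset.sum_mul]
    refine Fintype.sum_equiv (Equiv.mulRight g) _ _ fun a => ?_
    simp only [Equiv.coe_mulRight, hMmul, Matrix.conjTranspose_mul]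
    rw [Matrix.mul_assoc, Matrix.mul_assoc, Matrix.mul_assoc, ← hMmul g, mul_inv_cancel, hM1,
      Matrix.mul_one]
  have hdet : IsUnit P.det := (Matrix.isUnit_iff_isUnit_det _).1 hP.isUnit
  rw [hchar, hchar]
  have h2 : M g⁻¹ = P⁻¹ * ((M g).conjTranspose * P) := by
    rw [hinv, ← Matrix.mul_assoc, Matrix.nonsing_inv_mul _ hdet, Matrix.one_mul]
  rw [h2, Matrix.trace_mul_comm, Matrix.mul_assoc, Matrix.mul_nonsing_inv _ hdet, Matrix.mul_one,
    Matrix.trace_conjTranspose]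
  rfl

theorem charInner_eq_sum {G : Type*} [Group G] [Fintype G] (f g : G → ℂ) :
    charInner f g = (Nat.card G : ℂ)⁻¹ * ∑ x, f x * (starRingEnd ℂ) (g x) := by
  rw [charInner, finsum_eq_sum_of_fintype]

theorem charInner_add_left {G : Type*} [Group G] [Finite G] (f f' g : G → ℂ) :
    charInner (f + f') g = charInner f g + charInner f' g := by
  have := Fintype.ofFinite G
  simp [charInner_eq_sum, add_mul, mul_add, Finset.sum_add_distrib]

theorem charInner_smul_left {G : Type*} [Group G] [Finite G] (c : ℂ) (f g : G → ℂ) :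
    charInner (c • f) g = c * charInner f g := by
  have := Fintype.ofFinite G
  simp only [charInner_eq_sum, Pi.smul_apply, smul_eq_mul, mul_assoc, ← Finset.mul_sum]
  ring

theorem charInner_zero_left {G : Type*} [Group G] [Finite G] (g : G → ℂ) :
    charInner 0 g = 0 := by
  have := Fintype.ofFinite G
  simp [charInner_eq_sum]

theorem charInner_conj_symm {G : Type*} [Group G] [Finite G] (f g : G → ℂ) :
    (starRingEnd ℂ) (charInner f g) = charInner g f := by
  have := Fintype.ofFinite G
  simp [charInner_eq_sum, mul_comm]

/-- The inner product against a fixed function, as a linear functional. -/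
noncomputable def charInnerLeft {G : Type*} [Group G] [Finite G] (g : G → ℂ) :
    (G → ℂ) →ₗ[ℂ] ℂ where
  toFun f := charInner f g
  map_add' f f' := charInner_add_left f f' g
  map_smul' c f := charInner_smul_left c f g

/-- The inner product of two characters is the dimension of a space of intertwining maps. -/
theorem charInner_character {G : Type*} [Group G] [Finite G] {n m : ℕ}
    (ρ : Representation ℂ G (Fin n → ℂ)) (σ : Representation ℂ G (Fin m → ℂ)) :
    charInner ρ.character σ.character =
      (finrank ℂ (Representation.IntertwiningMap σ ρ) : ℂ) := by
  have := Fintype.ofFinite G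
  have : Invertible (Nat.card G : ℂ) := invertibleOfNonzero (by exact_mod_cast Nat.card_pos.ne')
  rw [charInner_eq_sum, ← Representation.card_inv_mul_sum_char_mul_char_eq_finrank]
  simp only [character_inv]

theorem exists_nat_charInner {G : Type*} [Group G] [Finite G] {χ θ : G → ℂ}
    (hχ : IsCharacter χ) (hθ : IsCharacter θ) : ∃ m : ℕ, charInner χ θ = m := by
  obtain ⟨n, ρ, -, rfl⟩ := hχ
  obtain ⟨m, σ, -, rfl⟩ := hθ
  exact ⟨_, charInner_character ρ σ⟩

theorem charInner_irr {G : Type*} [Group G] [Finite G] {θ η : G → ℂ}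
    (hθ : θ ∈ irr G) (hη : η ∈ irr G) [Decidable (θ = η)] :
    charInner θ η = if θ = η then 1 else 0 := by
  obtain ⟨n, ρ, hρ, rfl⟩ := hθ
  obtain ⟨m, σ, hσ, rfl⟩ := hη
  split_ifs with h
  · rw [← h, charInner_character, Representation.IsIrreducible.finrank_intertwiningMap_self]
    simp
  · rw [charInner_character]
    have : IsEmpty (Representation.Equiv σ ρ) := ⟨fun e => h (Representation.char_iso e).symm⟩
    simp [finrank_eq_zero_of_subsingleton]

theorem charInner_self_ne_zero {G : Type*} [Group G] [Finite G] {f : G → ℂ} (hf : f ≠ 0) :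
    charInner f f ≠ 0 := by
  have := Fintype.ofFinite G
  rw [charInner_eq_sum]
  refine mul_ne_zero (inv_ne_zero (by exact_mod_cast Nat.card_pos.ne')) ?_
  simp only [Complex.mul_conj]
  norm_cast
  intro h
  rw [Finset.sum_eq_zero_iff_of_nonneg fun x _ => Complex.normSq_nonneg _] at h
  exact hf (funext fun x => Complex.normSq_eq_zero.1 (h x (Finset.mem_univ x)))

theorem IsCharacter.apply_one_ne_zero {G : Type*} [Group G] {χ : G → ℂ} (hχ : IsCharacter χ) :
    χ 1 ≠ 0 := by
  obtain ⟨n, ρ, hn, rfl⟩ := hχ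
  simpa using hn

theorem IsCharacter.ne_zero {G : Type*} [Group G] {χ : G → ℂ} (hχ : IsCharacter χ) : χ ≠ 0 :=
  fun h => hχ.apply_one_ne_zero (congrFun h 1)

theorem IsCharacter.conj_apply {G : Type*} [Group G] {χ : G → ℂ} (hχ : IsCharacter χ) (g x : G) :
    χ (g * x * g⁻¹) = χ x := by
  obtain ⟨n, ρ, hn, rfl⟩ := hχ
  exact ρ.char_conj x g

theorem character_eq_add_of_isCompl {G : Type*} [Group G] {V : Type*} [AddCommGroup V]
    [Module ℂ V] [FiniteDimensional ℂ V] {ρ : Representation ℂ G V} {U W : Subrepresentation ρ}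
    (h : IsCompl U W) :
    ρ.character = U.toRepresentation.character + W.toRepresentation.character := by
  have h' : IsCompl U.toSubmodule W.toSubmodule := by
    rw [isCompl_iff, disjoint_iff, codisjoint_iff, ← Subrepresentation.toSubmodule_inf,
      ← Subrepresentation.toSubmodule_sup, h.inf_eq_bot, h.sup_eq_top]
    exact ⟨rfl, rfl⟩
  funext g
  let e := Submodule.prodEquivOfIsCompl _ _ h'
  have : ρ g = e.conj ((U.toRepresentation g).prodMap (W.toRepresentation g)) := by
    apply LinearMap.ext
    intro y
    obtain ⟨x, rfl⟩ := e.surjective y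
    simp only [LinearEquiv.conj_apply, LinearMap.comp_apply, LinearEquiv.coe_coe,
      LinearEquiv.symm_apply_apply]
    simp [e, Submodule.coe_prodEquivOfIsCompl', Subrepresentation.toRepresentation]
  simp only [Representation.character, Pi.add_apply]
  rw [this, LinearMap.trace_conj', LinearMap.trace_prodMap']

/-- By Maschke's theorem, every character is a sum of irreducible characters. -/
theorem character_mem_closure_irr {G : Type*} [Group G] [Finite G] (d : ℕ) :
    ∀ (V : Type) [AddCommGroup V] [Module ℂ V] [FiniteDimensional ℂ V]
      (ρ : Representation ℂ G V), finrank ℂ V = d →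
      ρ.character ∈ AddSubmonoid.closure (irr G) := by
  induction d using Nat.strong_induction_on with
  | _ d ih =>
    intro V _ _ _ ρ hd
    by_cases hsub : Subsingleton V
    · have : ρ.character = 0 := by
        funext g
        have : ρ g = 0 := LinearMap.ext fun x => Subsingleton.elim _ _
        simp [Representation.character, this]
      rw [this]
      exact zero_mem _
    by_cases hirr : ρ.IsIrreducible
    · exact AddSubmonoid.subset_closure (mem_irr_of_rep ρ hirr)
    have : NeZero (Nat.card G : ℂ) := ⟨by exact_mod_cast Nat.card_pos.ne'⟩
    have hnt : Nontrivial (Subrepresentation ρ) := by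
      refine ⟨⊥, ⊤, fun h => hsub ?_⟩
      have h' : (⊥ : Submodule ℂ V) = ⊤ := congrArg Subrepresentation.toSubmodule h
      exact Submodule.subsingleton_iff ℂ |>.1 (subsingleton_of_bot_eq_top h')
    have hU : ∃ U : Subrepresentation ρ, U ≠ ⊥ ∧ U ≠ ⊤ := by
      by_contra! hcon
      exact hirr ⟨fun U => or_iff_not_imp_left.2 (hcon U)⟩
    obtain ⟨U, hU0, hU1⟩ := hU
    obtain ⟨W, hUW⟩ := exists_isCompl U
    have key : ∀ X : Subrepresentation ρ, X ≠ ⊤ → finrank ℂ X.toSubmodule < d := by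
      intro X hX
      rw [← hd]
      refine Submodule.finrank_lt fun h => hX ?_
      exact Subrepresentation.toSubmodule_injective h
    have hW1 : W ≠ ⊤ := fun h => hU0 (by simpa [h] using hUW.inf_eq_bot)
    rw [character_eq_add_of_isCompl hUW]
    exact add_mem (ih _ (key U hU1) _ _ rfl) (ih _ (key W hW1) _ _ rfl)

theorem IsCharacter.mem_closure_irr {G : Type*} [Group G] [Finite G] {χ : G → ℂ}
    (hχ : IsCharacter χ) : χ ∈ AddSubmonoid.closure (irr G) := by
  obtain ⟨n, ρ, -, rfl⟩ := hχ
  exact character_mem_closure_irr _ _ ρ rfl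

theorem charInner_add_right {G : Type*} [Group G] [Finite G] (f g g' : G → ℂ) :
    charInner f (g + g') = charInner f g + charInner f g' := by
  rw [← charInner_conj_symm, charInner_add_left, map_add, charInner_conj_symm,
    charInner_conj_symm]

/-- Two characters are non-orthogonal exactly when they share an irreducible constituent. -/
theorem charInner_ne_zero_iff {G : Type*} [Group G] [Finite G] {χ χ' : G → ℂ}
    (hχ : IsCharacter χ) (hχ' : IsCharacter χ') :
    charInner χ χ' ≠ 0 ↔ ∃ θ ∈ irr G, IsConstituent θ χ ∧ IsConstituent θ χ' := by
  classical
  -- All inner products below are natural numbers, so a sum of them vanishes only termwise.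
  have key : ∀ χ' ∈ AddSubmonoid.closure (irr G), (∀ θ ∈ irr G, ∃ m : ℕ, charInner χ' θ = m) ∧
      (∃ m : ℕ, charInner χ χ' = m) ∧
      (charInner χ χ' ≠ 0 ↔ ∃ θ ∈ irr G, IsConstituent θ χ ∧ IsConstituent θ χ') := by
    intro χ' h
    induction h using AddSubmonoid.closure_induction with
    | mem η hη =>
      refine ⟨fun θ hθ => exists_nat_charInner (irr_subset_isCharacter hη)
        (irr_subset_isCharacter hθ), exists_nat_charInner hχ (irr_subset_isCharacter hη),
        fun h => ⟨η, hη, h, charInner_self_ne_zero (irr_subset_isCharacter hη).ne_zero⟩, ?_⟩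
      rintro ⟨θ, hθ, h1, h2⟩
      rw [IsConstituent, charInner_irr hη hθ] at h2
      have : η = θ := by by_contra hne; simp [hne] at h2
      rwa [this]
    | zero =>
      have h0 : charInner χ 0 = 0 := by
        rw [← charInner_conj_symm, charInner_zero_left, map_zero]
      refine ⟨fun θ _ => ⟨0, by simp [charInner_zero_left]⟩, ⟨0, by simp [h0]⟩, ?_⟩
      simp [IsConstituent, h0, charInner_zero_left]
    | add a b _ _ iha ihb =>
      obtain ⟨a1, ⟨p, hp⟩, a3⟩ := iha
      obtain ⟨b1, ⟨q, hq⟩, b3⟩ := ihb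
      refine ⟨fun θ hθ => ?_, ⟨p + q, by rw [charInner_add_right, hp, hq]; simp⟩, ?_⟩
      · obtain ⟨r, hr⟩ := a1 θ hθ
        obtain ⟨s, hs⟩ := b1 θ hθ
        exact ⟨r + s, by rw [charInner_add_left, hr, hs]; simp⟩
      · have h1 : charInner χ (a + b) ≠ 0 ↔ charInner χ a ≠ 0 ∨ charInner χ b ≠ 0 := by
          rw [charInner_add_right, hp, hq]
          norm_cast
          omega
        rw [h1, a3, b3, ← exists_or]
        refine exists_congr fun θ => ?_
        rw [← and_or_left]
        refine and_congr_right fun hθ => ?_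
        rw [← and_or_left]
        refine and_congr_right fun _ => ?_
        obtain ⟨r, hr⟩ := a1 θ hθ
        obtain ⟨s, hs⟩ := b1 θ hθ
        rw [IsConstituent, IsConstituent, IsConstituent, charInner_add_left, hr, hs]
        norm_cast
        omega
  exact (key χ' hχ'.mem_closure_irr).2.2

/-! ### Induced characters -/

/-- The space of functions `F : G → W` with `F(mx) = ρ(m) F(x)` for `m ∈ M`, which carries the
representation induced from the representation `ρ` of `M` on `W`. -/
def inducedSpace {G : Type*} [Group G] {M : Subgroup G} {W : Type*} [AddCommGroup W] [Module ℂ W]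
    (ρ : Representation ℂ M W) : Submodule ℂ (G → W) where
  carrier := {F | ∀ (m : M) (x : G), F (m * x) = ρ m (F x)}
  add_mem' hF hF' m x := by simp [hF m x, hF' m x]
  zero_mem' m x := by simp
  smul_mem' c F hF m x := by simp [hF m x]

/-- The induced representation: `G` acts by right translation on `inducedSpace ρ`. -/
def inducedRep {G : Type*} [Group G] {M : Subgroup G} {W : Type*} [AddCommGroup W] [Module ℂ W]
    (ρ : Representation ℂ M W) : Representation ℂ G (inducedSpace ρ) where
  toFun g :=
    { toFun := fun F => ⟨fun x => F.1 (x * g), fun m x => by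
        simpa [mul_assoc] using F.2 m (x * g)⟩
      map_add' := fun _ _ => rfl
      map_smul' := fun _ _ => rfl }
  map_one' := by ext F x; simp
  map_mul' a b := by ext F x; simp [mul_assoc]

/-- The averaging projection of `G → W` onto `inducedSpace ρ`, followed by right translation
by `g`. -/
noncomputable def averagedTranslation {G : Type*} [Group G] {M : Subgroup G} [Fintype M]
    {W : Type*} [AddCommGroup W] [Module ℂ W] (ρ : Representation ℂ M W) (g : G) :
    (G → W) →ₗ[ℂ] (G → W) where
  toFun F x := (Nat.card M : ℂ)⁻¹ • ∑ m : M, ρ m⁻¹ (F (m * x * g))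
  map_add' F F' := by ext x; simp [Finset.sum_add_distrib]
  map_smul' c F := by ext x; simp [← Finset.smul_sum, smul_comm c]

theorem averagedTranslation_mem {G : Type*} [Group G] {M : Subgroup G} [Fintype M]
    {W : Type*} [AddCommGroup W] [Module ℂ W] (ρ : Representation ℂ M W) (g : G) (F : G → W) :
    averagedTranslation ρ g F ∈ inducedSpace ρ := by
  intro m x
  simp only [averagedTranslation, LinearMap.coe_mk, AddHom.coe_mk, map_smul, map_sum]
  congr 1
  refine Fintype.sum_equiv (Equiv.mulRight m) _ _ fun k => ?_
  simp [← Module.End.mul_apply, ← map_mul, mul_assoc]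

theorem averagedTranslation_apply_of_mem {G : Type*} [Group G] {M : Subgroup G} [Fintype M]
    {W : Type*} [AddCommGroup W] [Module ℂ W] (ρ : Representation ℂ M W) (g : G) {F : G → W}
    (hF : F ∈ inducedSpace ρ) (x : G) : averagedTranslation ρ g F x = F (x * g) := by
  have h : ∀ m : M, ρ m⁻¹ (F (m * x * g)) = F (x * g) := fun m => by
    rw [mul_assoc, hF, ← Module.End.mul_apply, ← map_mul]
    simp
  simp only [averagedTranslation, LinearMap.coe_mk, AddHom.coe_mk, h]
  rw [Finset.sum_const, Finset.card_univ, ← Nat.card_eq_fintype_card, ← Nat.cast_smul_eq_nsmul ℂ,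
    smul_smul, inv_mul_cancel₀ (by exact_mod_cast Nat.card_pos.ne'), one_smul]

theorem trace_averagedTranslation {G : Type*} [Group G] [Finite G] {M : Subgroup G} [Fintype M]
    {n : ℕ} (ρ : Representation ℂ M (Fin n → ℂ)) (g : G) :
    LinearMap.trace ℂ _ (averagedTranslation ρ g) = ind M ρ.character g := by
  classical
  have := Fintype.ofFinite G
  rw [ind, finsum_eq_sum_of_fintype,
    LinearMap.trace_eq_matrix_trace ℂ (Pi.basis fun _ : G => Pi.basisFun ℂ (Fin n)),
    Matrix.trace, Fintype.sum_sigma, Finset.mul_sum]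
  refine Finset.sum_congr rfl fun x _ => ?_
  simp only [Matrix.diag_apply, LinearMap.toMatrix_apply, Pi.basis_apply, Pi.basis_repr,
    averagedTranslation, LinearMap.coe_mk, AddHom.coe_mk, Pi.basisFun_repr, Pi.basisFun_apply,
    Pi.smul_apply, smul_eq_mul, Finset.sum_apply]
  rw [← Finset.mul_sum, Finset.sum_comm]
  congr 1
  -- Only `m = x g⁻¹ x⁻¹` contributes to the diagonal entries at `x`.
  have hterm : ∀ m : M, ∑ i, ρ m⁻¹ ((Pi.single x (Pi.single i (1 : ℂ)) : G → Fin n → ℂ)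
      (m * x * g)) i = if (m : G) * x * g = x then ρ.character m⁻¹ else 0 := by
    intro m
    split_ifs with h
    · rw [h, Representation.character,
        LinearMap.trace_eq_matrix_trace ℂ (Pi.basisFun ℂ (Fin n)), Matrix.trace]
      simp
    · simp [Pi.single_eq_of_ne h]
  rw [Finset.sum_congr rfl fun m _ => hterm m]
  have hiff : ∀ m : M, (m : G) * x * g = x ↔ ((m⁻¹ : M) : G) = x * g * x⁻¹ := by
    intro m
    rw [Subgroup.coe_inv, inv_eq_iff_eq_inv, mul_assoc, ← eq_mul_inv_iff_mul_eq]
    simp [mul_assoc]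
  simp only [hiff]
  split_ifs with hx
  · rw [Finset.sum_eq_single (⟨x * g * x⁻¹, hx⟩⁻¹ : M)]
    · simp
    · intro m _ hm
      rw [if_neg]
      intro h
      exact hm (inv_eq_iff_eq_inv.1 (Subtype.ext h))
    · simp
  · refine Finset.sum_eq_zero fun m _ => if_neg fun h => hx ?_
    rw [← h]
    exact (m⁻¹).2

/-- A character induced from a subgroup is a character. -/
theorem IsCharacter.ind {G : Type*} [Group G] [Finite G] {M : Subgroup G} {χ : M → ℂ}
    (hχ : IsCharacter χ) : IsCharacter (ind M χ) := by
  classical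
  have := Fintype.ofFinite G
  obtain ⟨n, ρ, hn, rfl⟩ := hχ
  have hchar : (inducedRep ρ).character = Supercharacter.ind M ρ.character := by
    funext g
    rw [← trace_averagedTranslation, Representation.character,
      ← LinearMap.trace_restrict_eq_of_forall_mem (inducedSpace ρ) (averagedTranslation ρ g)
        (averagedTranslation_mem ρ g)]
    congr 1
    ext F x : 3
    exact (averagedTranslation_apply_of_mem ρ g F.2 x).symm
  have hone : (inducedRep ρ).character 1 ≠ 0 := by
    rw [hchar, Supercharacter.ind, finsum_eq_sum_of_fintype]
    have hsum : ∀ h : (1 : G) ∈ M, ρ.character ⟨1, h⟩ = n := fun h => by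
      exact ρ.char_one.trans (by simp)
    simp [one_mem, hsum, hn]
  have : Nontrivial (inducedSpace ρ) := by
    rw [Representation.char_one] at hone
    exact nontrivial_of_finrank_pos (R := ℂ) (Nat.pos_of_ne_zero (by exact_mod_cast hone))
  rw [← hchar]
  exact isCharacter_of_rep _

/-! ### Functions constant on the blocks of a partition -/

/-- The functions that are constant on every member of `c`. -/
def blockFunctions {α : Type*} (c : Set (Set α)) : Submodule ℂ (α → ℂ) where
  carrier := {f | ∀ C ∈ c, ∀ x ∈ C, ∀ y ∈ C, f x = f y}
  add_mem' hf hf' C hC x hx y hy := by simp [hf C hC x hx y hy, hf' C hC x hx y hy]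
  zero_mem' C hC x hx y hy := rfl
  smul_mem' a f hf C hC x hx y hy := by simp [hf C hC x hx y hy]

theorem finrank_blockFunctions {α : Type*} [Finite α] {c : Set (Set α)}
    (hc : Setoid.IsPartition c) : finrank ℂ (blockFunctions c) = c.ncard := by
  have hne : ∀ C : c, (C : Set α).Nonempty := fun C => Setoid.nonempty_of_mem_partition hc C.2
  choose b hb huniq using hc.2
  choose p hp using hne
  let e : blockFunctions c ≃ₗ[ℂ] (c → ℂ) :=
    { toFun := fun f C => f.1 (p C)
      map_add' := fun _ _ => rfl
      map_smul' := fun _ _ => rfl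
      invFun := fun φ => ⟨fun x => φ ⟨b x, (hb x).1⟩, fun C hC x hx y hy => by
        have hx' := huniq x C ⟨hC, hx⟩
        have hy' := huniq y C ⟨hC, hy⟩
        exact congrArg φ (Subtype.ext (hx'.symm.trans hy'))⟩
      left_inv := fun f => by
        ext x
        exact f.2 (b x) (hb x).1 _ (hp ⟨b x, _⟩) _ (hb x).2
      right_inv := fun φ => by
        funext C
        have := huniq (p C) C ⟨C.2, hp C⟩
        simp only
        congr 1
        exact Subtype.ext this.symm }
  have := Fintype.ofFinite c
  rw [e.finrank_eq, finrank_pi, ← Nat.card_eq_fintype_card, Nat.card_coe_set_eq]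

/-- A finite form of the Stone--Weierstrass theorem: the classes being those of the equivalence
relation defined by `V`, a unital subalgebra `V` of `α → ℂ` contains all functions that are
constant on the classes. -/
theorem mem_of_separates {α : Type*} [Finite α] (V : Submodule ℂ (α → ℂ)) (hone : 1 ∈ V)
    (hmul : ∀ f ∈ V, ∀ g ∈ V, f * g ∈ V) (f : α → ℂ)
    (hf : ∀ x y, (∀ g ∈ V, g x = g y) → f x = f y) : f ∈ V := by
  classical
  have := Fintype.ofFinite α
  let r : α → α → Prop := fun x y => ∀ g ∈ V, g x = g y
  -- For `x ≁ y` some member of `V` is `1` at `x` and `0` at `y`.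
  have hsep : ∀ x y, ∃ g ∈ V, g x = 1 ∧ (¬ r x y → g y = 0) := by
    intro x y
    by_cases hxy : r x y
    · exact ⟨1, hone, rfl, fun h => absurd hxy h⟩
    · simp only [r, not_forall] at hxy
      obtain ⟨g, hg, hne⟩ := hxy
      refine ⟨(g x - g y)⁻¹ • (g - g y • 1),
        V.smul_mem _ (V.sub_mem hg (V.smul_mem _ hone)), ?_, fun _ => ?_⟩
      · simp [inv_mul_cancel₀ (sub_ne_zero.2 hne)]
      · simp
  choose g hgV hgx hgy using hsep
  have hprod : ∀ (x : α) (s : Finset α), (∏ y ∈ s, g x y) ∈ V := by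
    intro x s
    induction s using Finset.induction_on with
    | empty => simpa using hone
    | insert a s ha ih => rw [Finset.prod_insert ha]; exact hmul _ (hgV x a) _ ih
  have hind : ∀ x, (fun z => if r x z then (1 : ℂ) else 0) ∈ V := by
    intro x
    convert hprod x Finset.univ using 1
    funext z
    split_ifs with h
    · rw [← h _ (hprod x _), Finset.prod_apply]
      simp [hgx]
    · rw [Finset.prod_apply]
      exact (Finset.prod_eq_zero (f := fun y => g x y z) (Finset.mem_univ z) (hgy x z h)).symm
  have hcard : ∀ z, (((Finset.univ.filter fun x => r x z).card : ℕ) : ℂ) ≠ 0 := by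
    intro z
    have : z ∈ Finset.univ.filter fun x => r x z := by simp [r]
    exact_mod_cast (Finset.card_pos.2 ⟨z, this⟩).ne'
  have hcard_eq : ∀ x z, r x z → (Finset.univ.filter fun y => r y x) =
      (Finset.univ.filter fun y => r y z) := by
    intro x z h
    ext y
    simp only [Finset.mem_filter, Finset.mem_univ, true_and]
    exact ⟨fun h' k hk => (h' k hk).trans (h k hk), fun h' k hk => (h' k hk).trans (h k hk).symm⟩
  have hsum : f = ∑ x, (f x * (((Finset.univ.filter fun y => r y x).card : ℕ) : ℂ)⁻¹) •
      (fun z => if r x z then (1 : ℂ) else 0) := by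
    funext z
    rw [Finset.sum_apply]
    simp only [Pi.smul_apply, smul_eq_mul, mul_ite, mul_one, mul_zero]
    rw [← Finset.sum_filter, Finset.sum_congr rfl
      (g := fun _ => f z * (((Finset.univ.filter fun y => r y z).card : ℕ) : ℂ)⁻¹)]
    · rw [Finset.sum_const, nsmul_eq_mul]
      field_simp [hcard z]
    · intro x hx
      have hx' : r x z := (Finset.mem_filter.1 hx).2
      rw [hf x z hx', hcard_eq x z hx']
  rw [hsum]
  exact V.sum_mem fun x _ => V.smul_mem _ (hind x)

/-! ### Supercharacter theories and the span of the supercharacters -/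

theorem linearIndependent_of_orthogonal {G : Type*} [Group G] [Finite G] {X : Set (G → ℂ)}
    (hne : ∀ χ ∈ X, χ ≠ 0) (hX : ∀ χ ∈ X, ∀ χ' ∈ X, χ ≠ χ' → charInner χ χ' = 0) :
    LinearIndependent ℂ (Subtype.val : X → G → ℂ) := by
  classical
  rw [linearIndependent_iff']
  intro s a hs χ hχ
  have h := congrArg (charInnerLeft (χ : G → ℂ)) hs
  rw [map_sum, map_zero, Finset.sum_eq_single χ] at h
  · rw [map_smul, smul_eq_mul] at h
    exact (mul_eq_zero.1 h).resolve_right (charInner_self_ne_zero (hne _ χ.2))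
  · intro χ' _ hne'
    rw [map_smul, smul_eq_mul]
    have : charInnerLeft (χ : G → ℂ) (χ' : G → ℂ) = 0 :=
      hX _ χ'.2 _ χ.2 fun h => hne' (Subtype.ext h)
    rw [this, mul_zero]
  · exact fun h => absurd hχ h

theorem SupercharacterTheory.charInner_eq_zero {G : Type*} [Group G] [Finite G]
    (T : SupercharacterTheory G) {χ χ' : G → ℂ} (hχ : χ ∈ T.supercharacters)
    (hχ' : χ' ∈ T.supercharacters) (hne : χ ≠ χ') : charInner χ χ' = 0 := by
  by_contra h
  obtain ⟨θ, hθ, h1, h2⟩ :=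
    (charInner_ne_zero_iff (T.isCharacter χ hχ) (T.isCharacter χ' hχ')).1 h
  exact hne ((T.existsUnique_constituent θ hθ).unique ⟨hχ, h1⟩ ⟨hχ', h2⟩)

/-- The supercharacters span the superclass functions: they are linearly independent, and there are
as many of them as superclasses. -/
theorem SupercharacterTheory.span_supercharacters {G : Type*} [Group G] [Finite G]
    (T : SupercharacterTheory G) :
    Submodule.span ℂ T.supercharacters = blockFunctions T.superclasses := by
  have hli := linearIndependent_of_orthogonal
    (fun χ hχ => (T.isCharacter χ hχ).ne_zero) (fun χ hχ χ' hχ' => T.charInner_eq_zero hχ hχ')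
  have := hli.finite
  have := Fintype.ofFinite T.supercharacters
  refine Submodule.eq_of_le_of_finrank_eq (Submodule.span_le.2 fun χ hχ => T.constant χ hχ) ?_
  rw [finrank_blockFunctions T.isPartition, Set.ncard, ← T.encard_eq, ← Set.ncard,
    ← Nat.card_coe_set_eq, Nat.card_eq_fintype_card, ← finrank_span_eq_card hli,
    Subtype.range_coe]

/-- A set of pairwise orthogonal characters whose span is a unital subalgebra of `G → ℂ` containing
(a multiple of) the regular character is the set of supercharacters of a supercharacter theory. -/
theorem exists_supercharacterTheory {G : Type*} [Group G] [Finite G] [DecidableEq G]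
    (X : Set (G → ℂ)) (hchar : ∀ χ ∈ X, IsCharacter χ)
    (horth : ∀ χ ∈ X, ∀ χ' ∈ X, χ ≠ χ' → charInner χ χ' = 0)
    (hone : (1 : G → ℂ) ∈ Submodule.span ℂ X)
    (hmul : ∀ χ ∈ X, ∀ χ' ∈ X, χ * χ' ∈ Submodule.span ℂ X)
    (hreg : (Pi.single 1 1 : G → ℂ) ∈ Submodule.span ℂ X) :
    ∃ T : SupercharacterTheory G, T.supercharacters = X := by
  have hmul' : ∀ f ∈ Submodule.span ℂ X, ∀ g ∈ Submodule.span ℂ X,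
      f * g ∈ Submodule.span ℂ X := by
    intro f hf g hg
    induction hf, hg using Submodule.span_induction₂ with
    | mem_mem x y hx hy => exact hmul x hx y hy
    | zero_left y hy => rw [zero_mul]; exact zero_mem _
    | zero_right x hx => rw [mul_zero]; exact zero_mem _
    | add_left x y z _ _ _ h1 h2 => rw [add_mul]; exact add_mem h1 h2
    | add_right x y z _ _ _ h1 h2 => rw [mul_add]; exact add_mem h1 h2
    | smul_left r x y _ _ h => rw [smul_mul_assoc]; exact Submodule.smul_mem _ _ h
    | smul_right r x y _ _ h => rw [mul_smul_comm]; exact Submodule.smul_mem _ _ h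
  let s : Setoid G := ⟨fun x y => ∀ χ ∈ X, χ x = χ y,
    fun _ _ _ => rfl, fun h χ hχ => (h χ hχ).symm,
    fun h h' χ hχ => (h χ hχ).trans (h' χ hχ)⟩
  have hs : Setoid.IsPartition s.classes := Setoid.isPartition_classes s
  have hconst : ∀ χ ∈ X, ∀ C ∈ s.classes, ∀ x ∈ C, ∀ y ∈ C, χ x = χ y := by
    rintro χ hχ _ ⟨z, rfl⟩ x hx y hy
    exact (hx χ hχ).trans (hy χ hχ).symm
  have hspan : Submodule.span ℂ X = blockFunctions s.classes := by
    refine le_antisymm (Submodule.span_le.2 fun χ hχ => hconst χ hχ) fun f hf => ?_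
    refine mem_of_separates _ hone hmul' f fun x y hxy => ?_
    exact hf _ (s.mem_classes y) x (fun χ hχ => hxy χ (Submodule.subset_span hχ)) y (s.refl y)
  have hli := linearIndependent_of_orthogonal (fun χ hχ => (hchar χ hχ).ne_zero) horth
  have hXfin : X.Finite := hli.finite
  have := hXfin.to_subtype
  have := Fintype.ofFinite X
  refine ⟨⟨s.classes, X, hs, ?_, hchar, ?_, hconst, ?_⟩, rfl⟩
  · rintro _ ⟨z, rfl⟩ x hx g χ hχ
    rw [(hchar χ hχ).conj_apply]
    exact hx χ hχ
  · rw [← hXfin.cast_ncard_eq, ← (Set.toFinite s.classes).cast_ncard_eq,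
      ← finrank_blockFunctions hs, ← hspan, ← Nat.card_coe_set_eq, Nat.card_eq_fintype_card,
      ← finrank_span_eq_card hli, Subtype.range_coe]
  · intro θ hθ
    have hex : ∃ χ ∈ X, IsConstituent θ χ := by
      by_contra! hcon
      simp only [IsConstituent, not_not] at hcon
      have hker : Submodule.span ℂ X ≤ LinearMap.ker (charInnerLeft θ) :=
        Submodule.span_le.2 hcon
      have h0 : charInner (Pi.single 1 1 : G → ℂ) θ = 0 := hker hreg
      have := Fintype.ofFinite G
      have hθ1 := (irr_subset_isCharacter hθ).apply_one_ne_zero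
      rw [charInner_eq_sum, Finset.sum_eq_single 1] at h0
      · simp [hθ1] at h0
      · intro x _ hx
        simp [hx]
      · simp
    obtain ⟨χ, hχ, hθχ⟩ := hex
    refine ⟨χ, ⟨hχ, hθχ⟩, ?_⟩
    rintro χ' ⟨hχ', hθχ'⟩
    by_contra hne
    exact (charInner_ne_zero_iff (hchar χ' hχ') (hchar χ hχ)).2 ⟨θ, hθ, hθχ', hθχ⟩
      (horth χ' hχ' χ hχ hne)

/-! ### Irreducible characters of a finite abelian group -/

theorem mem_irr_iff_monoidHom {N : Type*} [CommGroup N] [Finite N] {ψ : N → ℂ} :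
    ψ ∈ irr N ↔ ∃ χ : N →* ℂ, ⇑χ = ψ := by
  constructor
  · rintro ⟨n, ρ, hρ, rfl⟩
    have hn : finrank ℂ (Fin n → ℂ) = 1 :=
      Representation.IsIrreducible.finrank_eq_one_of_isMulCommutative ρ
    rw [finrank_fin_fun] at hn
    subst hn
    have h : ∀ g, ρ.character g = LinearMap.toMatrix' (ρ g) 0 0 := fun g => by
      rw [Representation.character, LinearMap.trace_eq_matrix_trace ℂ (Pi.basisFun ℂ (Fin 1)),
        Matrix.trace_fin_one]
      rfl
    refine ⟨⟨⟨ρ.character, by simp⟩, fun a b => ?_⟩, rfl⟩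
    simp only [h, map_mul, LinearMap.toMatrix'_mul, Matrix.mul_apply, Fin.sum_univ_one]
  · rintro ⟨χ, rfl⟩
    let ρ : Representation ℂ N ℂ :=
      { toFun := fun n => χ n • LinearMap.id
        map_one' := by ext; simp
        map_mul' := fun a b => by ext; simp [mul_comm] }
    have hρ : ρ.IsIrreducible := by
      have hne : (⊥ : Subrepresentation ρ) ≠ ⊤ := fun h =>
        bot_ne_top (α := Submodule ℂ ℂ) (congrArg Subrepresentation.toSubmodule h)
      have : Nontrivial (Subrepresentation ρ) := ⟨⊥, ⊤, hne⟩
      exact ⟨fun U => (eq_bot_or_eq_top U.toSubmodule).imp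
        (fun h => Subrepresentation.toSubmodule_injective h)
        (fun h => Subrepresentation.toSubmodule_injective h)⟩
    have hc : ρ.character = χ := by
      funext n
      simp [Representation.character, ρ]
    exact hc ▸ mem_irr_of_rep ρ hρ

theorem mul_mem_irr {N : Type*} [CommGroup N] [Finite N] {ψ ψ' : N → ℂ} (hψ : ψ ∈ irr N)
    (hψ' : ψ' ∈ irr N) : (fun n => ψ n * ψ' n) ∈ irr N := by
  rw [mem_irr_iff_monoidHom] at *
  obtain ⟨χ, rfl⟩ := hψ
  obtain ⟨χ', rfl⟩ := hψ'
  exact ⟨χ * χ', rfl⟩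

theorem one_mem_irr {N : Type*} [CommGroup N] [Finite N] : (fun _ => 1 : N → ℂ) ∈ irr N :=
  mem_irr_iff_monoidHom.2 ⟨1, rfl⟩

theorem conjChar_mem_irr {N H : Type*} [CommGroup N] [Finite N] [Group H] {φ : H →* MulAut N}
    {ψ : N → ℂ} (hψ : ψ ∈ irr N) (h : H) :
    conjChar ψ (SemidirectProduct.inr h : N ⋊[φ] H) ∈ irr N := by
  rw [mem_irr_iff_monoidHom] at *
  obtain ⟨χ, rfl⟩ := hψ
  refine ⟨χ.comp (φ h).toMonoidHom, ?_⟩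
  funext n
  simp [conjChar, conjN_inr]

theorem conjChar_eq_conjChar_inr {N H : Type*} [CommGroup N] [Group H] {φ : H →* MulAut N}
    (ψ : N → ℂ) (g : N ⋊[φ] H) :
    conjChar ψ g = conjChar ψ (SemidirectProduct.inr g.right : N ⋊[φ] H) := by
  funext n
  rw [conjChar, conjChar, conjN_inr]
  congr 1
  simp [conjN, mul_comm]

/-- A family of irreducible characters of a finite abelian group `N` that sums to the regular
character, namely the family of all of them, indexed by the additive characters of
`Additive N`. -/
theorem exists_sum_irr_eq_single.{u} (N : Type u) [CommGroup N] [Finite N] [DecidableEq N] :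
    ∃ (ι : Type u) (_ : Fintype ι) (ψ : ι → N → ℂ), (∀ i, ψ i ∈ irr N) ∧
      ∀ n, ∑ i, ψ i n = if n = 1 then (Nat.card N : ℂ) else 0 := by
  have := Fintype.ofFinite N
  have : Fintype (Additive N) := Fintype.ofFinite _
  refine ⟨AddChar (Additive N) ℂ, inferInstance, fun χ n => χ (Additive.ofMul n), fun χ => ?_,
    fun n => ?_⟩
  · refine mem_irr_iff_monoidHom.2 ⟨⟨⟨fun n => χ (Additive.ofMul n), ?_⟩, fun a b => ?_⟩, rfl⟩
    · exact χ.map_zero_eq_one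
    · exact χ.map_add_eq_mul _ _
  · have h := AddChar.sum_apply_eq_ite (Additive.ofMul n)
    rw [h, ← Nat.card_eq_fintype_card]
    rfl

/-! ### Sums over all conjugates -/

/-- The sum of the conjugates `x ↦ F (g x g⁻¹)` of a function `F` on `G`. -/
def conjSum {G : Type*} [Group G] [Fintype G] : (G → ℂ) →ₗ[ℂ] (G → ℂ) where
  toFun F x := ∑ g, F (g * x * g⁻¹)
  map_add' F F' := by ext x; simp [Finset.sum_add_distrib]
  map_smul' c F := by ext x; simp [Finset.mul_sum]

theorem conjSum_apply {G : Type*} [Group G] [Fintype G] (F : G → ℂ) (x : G) :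
    conjSum F x = ∑ g, F (g * x * g⁻¹) := rfl

theorem conjSum_conj {G : Type*} [Group G] [Fintype G] (F : G → ℂ) (k : G) :
    conjSum (fun x => F (k * x * k⁻¹)) = conjSum F := by
  funext x
  exact Fintype.sum_equiv (Equiv.mulLeft k) _ _ fun g => by simp [mul_assoc]

theorem conjSum_apply_conj {G : Type*} [Group G] [Fintype G] (F : G → ℂ) (k x : G) :
    conjSum F (k * x * k⁻¹) = conjSum F x :=
  Fintype.sum_equiv (Equiv.mulRight k) _ _ fun g => by simp [mul_assoc]

/-- Mackey's formula for products, in terms of sums of conjugates. -/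
theorem conjSum_mul_conjSum {G : Type*} [Group G] [Fintype G] (F F' : G → ℂ) :
    conjSum F * conjSum F' = ∑ k : G, conjSum (fun x => F (k * x * k⁻¹) * F' x) := by
  funext x
  have h : ∀ k : G, conjSum F x * F' (k * x * k⁻¹) =
      ∑ g, F (g * (k * x * k⁻¹) * g⁻¹) * F' (k * x * k⁻¹) := fun k => by
    rw [← conjSum_apply_conj F k x, conjSum_apply, Finset.sum_mul]
  rw [Pi.mul_apply, conjSum_apply F', Finset.mul_sum, Finset.sum_congr rfl fun k _ => h k,
    Finset.sum_comm, Finset.sum_apply]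
  rfl

theorem charInner_conjSum_right {G : Type*} [Group G] [Fintype G] (F F' : G → ℂ) :
    charInner F (conjSum F') = ∑ k : G, charInner F (fun x => F' (k * x * k⁻¹)) := by
  simp only [charInner_eq_sum, conjSum_apply, map_sum, Finset.mul_sum]
  rw [Finset.sum_comm]

theorem charInner_conjSum {G : Type*} [Group G] [Fintype G] (F F' : G → ℂ) :
    charInner (conjSum F) (conjSum F') =
      (Nat.card G : ℂ) * ∑ k : G, charInner F (fun x => F' (k * x * k⁻¹)) := by
  rw [← charInner_conj_symm, charInner_conjSum_right, map_sum]
  have h : ∀ k : G, (starRingEnd ℂ) (charInner (conjSum F') fun x => F (k * x * k⁻¹)) =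
      charInner F (conjSum F') := fun k => by
    rw [charInner_conj_symm, charInner_eq_sum, charInner_eq_sum]
    congr 1
    refine Fintype.sum_equiv (MulAut.conj k).toEquiv _ _ fun x => ?_
    simp [conjSum_apply_conj]
  rw [Finset.sum_congr rfl fun k _ => h k, charInner_conjSum_right]
  simp [Nat.card_eq_fintype_card]

/-! ### Superclass functions extended by zero -/

open Classical in
/-- Extension by zero of a function on a subgroup, as a linear map. -/
noncomputable def zeroExt {H : Type*} [Group H] (K : Subgroup H) : (K → ℂ) →ₗ[ℂ] (H → ℂ) where
  toFun f x := if hx : x ∈ K then f ⟨x, hx⟩ else 0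
  map_add' f f' := by ext x; by_cases hx : x ∈ K <;> simp [hx]
  map_smul' c f := by ext x; by_cases hx : x ∈ K <;> simp [hx]

theorem zeroExt_of_mem {H : Type*} [Group H] {K : Subgroup H} (f : K → ℂ) {x : H} (hx : x ∈ K) :
    zeroExt K f x = f ⟨x, hx⟩ := dif_pos hx

theorem zeroExt_of_notMem {H : Type*} [Group H] {K : Subgroup H} (f : K → ℂ) {x : H}
    (hx : x ∉ K) : zeroExt K f x = 0 := dif_neg hx

theorem charInner_zeroExt {H : Type*} [Group H] [Finite H] (K : Subgroup H) (f f' : K → ℂ)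
    (h : charInner f f' = 0) : charInner (zeroExt K f) (zeroExt K f') = 0 := by
  classical
  have := Fintype.ofFinite H
  rw [charInner_eq_sum] at h ⊢
  have h' := (mul_eq_zero.1 h).resolve_left
    (inv_ne_zero (by exact_mod_cast Nat.card_pos.ne'))
  rw [← Finset.sum_filter_add_sum_filter_not Finset.univ (fun x => x ∈ K),
    Finset.sum_eq_zero (s := Finset.univ.filter fun x => x ∉ K), add_zero,
    ← Finset.sum_subtype_eq_sum_filter]
  · refine mul_eq_zero_of_right _ (Eq.trans ?_ h')
    refine Finset.sum_bij (fun x _ => ⟨x, x.2⟩) ?_ ?_ ?_ ?_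
    · simp
    · simp
    · simp
    · intro x _
      rw [zeroExt_of_mem f x.2, zeroExt_of_mem f' x.2]
  · intro x hx
    rw [zeroExt_of_notMem f (Finset.mem_filter.1 hx).2, zero_mul]

section Lattice

variable {H : Type*} [Group H] {L : Sublattice (Subgroup H)}

/-- The supercharacters of `K ∈ ℒ`, extended by zero to `H`. -/
noncomputable def extSupercharacters (T : ∀ K : L, SupercharacterTheory (K : Subgroup H)) (K : L) :
    Set (H → ℂ) :=
  zeroExt (K : Subgroup H) '' (T K).supercharacters

/-- The superclass functions of `K ∈ ℒ`, extended by zero to `H`. -/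
noncomputable def extSuperclassFunctions (T : ∀ K : L, SupercharacterTheory (K : Subgroup H)) (K : L) :
    Submodule ℂ (H → ℂ) :=
  (blockFunctions (T K).superclasses).map (zeroExt (K : Subgroup H))

variable {T : ∀ K : L, SupercharacterTheory (K : Subgroup H)}

theorem extSuperclassFunctions_eq_span [Finite H] (K : L) :
    extSuperclassFunctions T K = Submodule.span ℂ (extSupercharacters T K) := by
  rw [extSuperclassFunctions, ← SupercharacterTheory.span_supercharacters, Submodule.map_span]
  rfl

theorem eq_zero_of_mem_extSuperclassFunctions {K : L} {f : H → ℂ}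
    (hf : f ∈ extSuperclassFunctions T K) {x : H} (hx : x ∉ (K : Subgroup H)) : f x = 0 := by
  obtain ⟨f, -, rfl⟩ := hf
  exact zeroExt_of_notMem f hx

theorem mul_mem_extSuperclassFunctions
    (hL_res : ∀ K M : L, ∀ hKM : (K : Subgroup H) ≤ M, ∀ f : ↥(M : Subgroup H) → ℂ,
      (T M).IsSuperclassFunction f →
        (T K).IsSuperclassFunction (fun x => f (Subgroup.inclusion hKM x)))
    {K M : L} {f f' : H → ℂ} (hf : f ∈ extSuperclassFunctions T K)
    (hf' : f' ∈ extSuperclassFunctions T M) : f * f' ∈ extSuperclassFunctions T (K ⊓ M) := by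
  obtain ⟨f, hf, rfl⟩ := hf
  obtain ⟨f', hf', rfl⟩ := hf'
  have hK : ((K ⊓ M : L) : Subgroup H) ≤ K := inf_le_left (a := (K : Subgroup H))
  have hM : ((K ⊓ M : L) : Subgroup H) ≤ M := inf_le_right (a := (K : Subgroup H))
  refine ⟨fun x => f (Subgroup.inclusion hK x) * f' (Subgroup.inclusion hM x), ?_, ?_⟩
  · intro C hC x hx y hy
    have h1 := hL_res _ _ hK f hf C hC x hx y hy
    have h2 := hL_res _ _ hM f' hf' C hC x hx y hy
    beta_reduce at h1 h2 ⊢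
    rw [h1, h2]
  · funext x
    by_cases hx : x ∈ ((K ⊓ M : L) : Subgroup H)
    · rw [Pi.mul_apply, zeroExt_of_mem _ hx, zeroExt_of_mem _ (hK hx), zeroExt_of_mem _ (hM hx)]
      rfl
    · rw [Pi.mul_apply, zeroExt_of_notMem _ hx]
      by_cases hx1 : x ∈ (K : Subgroup H)
      · have hx2 : x ∉ (M : Subgroup H) := fun hx2 => hx ⟨hx1, hx2⟩
        rw [zeroExt_of_notMem f' hx2, mul_zero]
      · rw [zeroExt_of_notMem f hx1, zero_mul]

/-- Induction from `K` to `M`, written in terms of extensions by zero. -/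
theorem zeroExt_indTo [Finite H] (K M : Subgroup H) [Fintype M] (hKM : K ≤ M) (f : K → ℂ) :
    zeroExt M (indTo K M f) =
      (Nat.card (K.subgroupOf M) : ℂ)⁻¹ • fun x => ∑ m : M, zeroExt K f (m * x * (m : H)⁻¹) := by
  classical
  funext x
  by_cases hx : x ∈ M
  · rw [zeroExt_of_mem _ hx, indTo, ind, finsum_eq_sum_of_fintype, Pi.smul_apply, smul_eq_mul]
    congr 1
  · rw [zeroExt_of_notMem _ hx, Pi.smul_apply, Finset.sum_eq_zero, smul_zero]
    intro m _
    refine zeroExt_of_notMem _ fun h => hx ?_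
    have := M.mul_mem (M.mul_mem (M.inv_mem m.2) (hKM h)) m.2
    simpa [mul_assoc] using this

theorem sum_conj_mem_extSuperclassFunctions [Finite H]
    (hL_ind : ∀ K M : L, (K : Subgroup H) ≤ M → ∀ f : ↥(K : Subgroup H) → ℂ,
      (T K).IsSuperclassFunction f →
        (T M).IsSuperclassFunction (indTo (K : Subgroup H) (M : Subgroup H) f))
    {K M : L} [Fintype (M : Subgroup H)] (hKM : (K : Subgroup H) ≤ M) {f : H → ℂ}
    (hf : f ∈ extSuperclassFunctions T K) :
    (fun x => ∑ m : (M : Subgroup H), f (m * x * (m : H)⁻¹)) ∈ extSuperclassFunctions T M := by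
  obtain ⟨f, hf, rfl⟩ := hf
  have hmem : zeroExt (M : Subgroup H) (indTo (K : Subgroup H) (M : Subgroup H) f) ∈
      extSuperclassFunctions T M := ⟨_, hL_ind K M hKM f hf, rfl⟩
  rw [zeroExt_indTo _ _ hKM] at hmem
  exact (Submodule.smul_mem_iff _ (inv_ne_zero (by exact_mod_cast Nat.card_pos.ne'))).1 hmem

theorem zeroExt_conjFun (K : Subgroup H) (χ : K → ℂ) (h : H) :
    zeroExt (conjSubgroup K h) (conjFun χ h) = fun x => zeroExt K χ (h * x * h⁻¹) := by
  funext x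
  by_cases hx : h * x * h⁻¹ ∈ K
  · rw [zeroExt_of_mem _ hx, zeroExt_of_mem _ (mem_conjSubgroup.2 hx)]
    rfl
  · rw [zeroExt_of_notMem _ hx, zeroExt_of_notMem _ fun h => hx (mem_conjSubgroup.1 h)]

theorem conj_mem_extSupercharacters (hL_conj : ∀ K ∈ L, ∀ h : H, conjSubgroup K h ∈ L)
    (hL_conjChar : ∀ K : L, ∀ h : H, ∀ χ ∈ (T K).supercharacters,
      conjFun χ h ∈ (T ⟨conjSubgroup (K : Subgroup H) h, hL_conj K K.2 h⟩).supercharacters)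
    {K M : L} {f : H → ℂ} (hf : f ∈ extSupercharacters T K) (h : H)
    (hM : (M : Subgroup H) = conjSubgroup K h) :
    (fun x => f (h * x * h⁻¹)) ∈ extSupercharacters T M := by
  obtain rfl : M = ⟨conjSubgroup (K : Subgroup H) h, hL_conj K K.2 h⟩ := Subtype.ext hM
  obtain ⟨χ, hχ, rfl⟩ := hf
  exact ⟨conjFun χ h, hL_conjChar K h χ hχ, zeroExt_conjFun _ _ _⟩

theorem conj_mem_extSuperclassFunctions [Finite H]
    (hL_conj : ∀ K ∈ L, ∀ h : H, conjSubgroup K h ∈ L)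
    (hL_conjChar : ∀ K : L, ∀ h : H, ∀ χ ∈ (T K).supercharacters,
      conjFun χ h ∈ (T ⟨conjSubgroup (K : Subgroup H) h, hL_conj K K.2 h⟩).supercharacters)
    {K M : L} {f : H → ℂ} (hf : f ∈ extSuperclassFunctions T K) (h : H)
    (hM : (M : Subgroup H) = conjSubgroup K h) :
    (fun x => f (h * x * h⁻¹)) ∈ extSuperclassFunctions T M := by
  rw [extSuperclassFunctions_eq_span] at hf ⊢
  have := Submodule.mem_map_of_mem (f := LinearMap.funLeft ℂ ℂ fun x => h * x * h⁻¹) hf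
  rw [Submodule.map_span] at this
  refine Submodule.span_mono ?_ this
  rintro _ ⟨f', hf', rfl⟩
  exact conj_mem_extSupercharacters hL_conj hL_conjChar hf' h hM

theorem charInner_extSupercharacters [Finite H] {K : L} {f f' : H → ℂ}
    (hf : f ∈ extSupercharacters T K) (hf' : f' ∈ extSupercharacters T K) (hne : f ≠ f') :
    charInner f f' = 0 := by
  obtain ⟨χ, hχ, rfl⟩ := hf
  obtain ⟨χ', hχ', rfl⟩ := hf'
  exact charInner_zeroExt _ _ _
    ((T K).charInner_eq_zero hχ hχ' fun h => hne (by rw [h]))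

end Lattice

/-! ### Elementary functions on the semidirect product -/

section Semidirect

variable {N H : Type*} [CommGroup N] [Group H] {φ : H →* MulAut N}

/-- The function `(n, h) ↦ ψ(n) f(h)` on `N ⋊ H`. For `f` supported on a subgroup `K` it is the
extension by zero of the function `ψ̃ · Inf f` on `NK`. -/
noncomputable def outer (φ : H →* MulAut N) (ψ : N → ℂ) : (H → ℂ) →ₗ[ℂ] (N ⋊[φ] H → ℂ) where
  toFun f x := ψ x.left * f x.right
  map_add' f f' := by ext x; simp [mul_add]
  map_smul' c f := by ext x; simp [mul_left_comm]

theorem outer_apply (ψ : N → ℂ) (f : H → ℂ) (x : N ⋊[φ] H) :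
    outer φ ψ f x = ψ x.left * f x.right := rfl

/-- Conjugation acts on `outer φ ψ f` through `H` only, because `ψ` is invariant under the support
of `f`. -/
theorem outer_conj [Finite N] {ψ : N → ℂ} (hψ : ψ ∈ irr N) {f : H → ℂ}
    (hf : ∀ x ∉ inertia φ ψ, f x = 0) (g : N ⋊[φ] H) :
    (fun x => outer φ ψ f (g * x * g⁻¹)) =
      outer φ (conjChar ψ (SemidirectProduct.inr g.right : N ⋊[φ] H))
        (fun y => f (g.right * y * g.right⁻¹)) := by
  funext x
  simp only [outer_apply, SemidirectProduct.mul_right, SemidirectProduct.inv_right]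
  by_cases hx : g.right * x.right * g.right⁻¹ ∈ inertia φ ψ
  · congr 1
    obtain ⟨χ, rfl⟩ := mem_irr_iff_monoidHom.1 hψ
    have h1 := congrFun hx g.left⁻¹
    rw [conjChar, conjN_inr] at h1
    rw [conjChar, conjN_inr]
    have h2 : (g * x * g⁻¹).left =
        g.left * φ g.right x.left * φ (g.right * x.right * g.right⁻¹) g.left⁻¹ := by
      simp [mul_assoc]
    rw [h2, map_mul, map_mul, h1, mul_right_comm, ← map_mul, mul_inv_cancel, map_one, one_mul]
  · rw [hf _ hx, mul_zero, mul_zero]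

theorem charInner_outer [Finite N] [Finite H] (ψ ψ' : N → ℂ) (f f' : H → ℂ) :
    charInner (outer φ ψ f) (outer φ ψ' f') = charInner ψ ψ' * charInner f f' := by
  have := Fintype.ofFinite N
  have := Fintype.ofFinite H
  have : Fintype (N ⋊[φ] H) := Fintype.ofEquiv _ SemidirectProduct.equivProd.symm
  rw [charInner_eq_sum, charInner_eq_sum, charInner_eq_sum, SemidirectProduct.card,
    mul_mul_mul_comm, Finset.sum_mul_sum, ← Fintype.sum_prod_type',
    Fintype.sum_equiv SemidirectProduct.equivProd _
      (fun p : N × H => ψ p.1 * (starRingEnd ℂ) (ψ' p.1) * (f p.2 * (starRingEnd ℂ) (f' p.2)))]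
  · push_cast
    rw [mul_inv]
  · intro x
    simp only [outer_apply, map_mul, SemidirectProduct.equivProd, Equiv.coe_fn_mk]
    ring

/-! ### The supercharacters as sums of conjugates -/

/-- The constant with `ψ ⋊ Ind_K^{I_H(ψ)} χ = rtimesConst φ ψ K • conjSum (outer φ ψ χ)`. -/
noncomputable def rtimesConst (φ : H →* MulAut N) (ψ : N → ℂ) (K : Subgroup H) : ℂ :=
  (Nat.card (prodN φ (inertia φ ψ)) : ℂ)⁻¹ * (Nat.card (K.subgroupOf (inertia φ ψ)) : ℂ)⁻¹ *
    Nat.card (inertia φ ψ)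

theorem rtimesConst_ne_zero [Finite N] [Finite H] (ψ : N → ℂ) (K : Subgroup H) :
    rtimesConst φ ψ K ≠ 0 := by
  have : Finite (N ⋊[φ] H) := Finite.of_equiv _ SemidirectProduct.equivProd.symm
  refine mul_ne_zero (mul_ne_zero (inv_ne_zero ?_) (inv_ne_zero ?_)) ?_ <;>
    exact_mod_cast Nat.card_pos.ne'

theorem rtimes_indTo [Finite N] [Finite H] [Fintype (N ⋊[φ] H)] {ψ : N → ℂ} (hψ : ψ ∈ irr N)
    {K : Subgroup H} (hK : K ≤ inertia φ ψ) (χ : K → ℂ) :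
    rtimes φ ψ (indTo K (inertia φ ψ) χ) =
      rtimesConst φ ψ K • conjSum (outer φ ψ (zeroExt K χ)) := by
  classical
  have : Fintype (inertia φ ψ) := Fintype.ofFinite _
  have h1 : rtimes φ ψ (indTo K (inertia φ ψ) χ) =
      (Nat.card (prodN φ (inertia φ ψ)) : ℂ)⁻¹ •
        conjSum (outer φ ψ (zeroExt (inertia φ ψ) (indTo K (inertia φ ψ) χ))) := by
    funext x
    rw [rtimes, ind, finsum_eq_sum_of_fintype, Pi.smul_apply, smul_eq_mul, conjSum_apply]
    congr 1
    refine Finset.sum_congr rfl fun g _ => ?_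
    rw [outer_apply]
    by_cases hg : g * x * g⁻¹ ∈ prodN φ (inertia φ ψ)
    · rw [dif_pos hg, zeroExt_of_mem _ (show (g * x * g⁻¹).right ∈ inertia φ ψ from hg)]
    · rw [dif_neg hg, zeroExt_of_notMem _ (show (g * x * g⁻¹).right ∉ inertia φ ψ from hg),
        mul_zero]
  have h2 : (fun x => ∑ m : inertia φ ψ, zeroExt K χ (m * x * (m : H)⁻¹)) =
      ∑ m : inertia φ ψ, fun x => zeroExt K χ (m * x * (m : H)⁻¹) := by
    funext x
    rw [Finset.sum_apply]
  have h3 : ∀ m : inertia φ ψ,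
      conjSum (outer φ ψ fun x => zeroExt K χ (m * x * (m : H)⁻¹)) =
        conjSum (outer φ ψ (zeroExt K χ)) := fun m => by
    have h := outer_conj hψ (fun x hx => zeroExt_of_notMem χ fun h => hx (hK h))
      (SemidirectProduct.inr (m : H) : N ⋊[φ] H)
    have hm : conjChar ψ (SemidirectProduct.inr (m : H) : N ⋊[φ] H) = ψ := m.2
    rw [SemidirectProduct.right_inr, hm] at h
    rw [← h, conjSum_conj]
  rw [h1, zeroExt_indTo _ _ hK, map_smul, map_smul, h2, map_sum, map_sum,
    Finset.sum_congr rfl fun m _ => h3 m, Finset.sum_const, Finset.card_univ,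
    ← Nat.card_eq_fintype_card, ← Nat.cast_smul_eq_nsmul ℂ, smul_smul, smul_smul, rtimesConst,
    mul_assoc]

theorem IsCharacter.comp {G G' : Type*} [Group G] [Group G'] {χ : G → ℂ} (hχ : IsCharacter χ)
    (f : G' →* G) : IsCharacter fun x => χ (f x) := by
  obtain ⟨n, ρ, hn, rfl⟩ := hχ
  exact ⟨n, ρ.comp f, hn, rfl⟩

theorem IsCharacter.indTo [Finite H] {K M : Subgroup H} {χ : K → ℂ} (hχ : IsCharacter χ) :
    IsCharacter (indTo K M χ) :=
  IsCharacter.ind (hχ.comp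
    (((M.subtype.comp (K.subgroupOf M).subtype).codRestrict K fun x =>
      Subgroup.mem_subgroupOf.1 x.2)))

theorem IsCharacter.rtimes [Finite N] [Finite H] {ψ : N → ℂ} (hψ : ψ ∈ irr N)
    {χ : inertia φ ψ → ℂ} (hχ : IsCharacter χ) : IsCharacter (rtimes φ ψ χ) := by
  have : Finite (N ⋊[φ] H) := Finite.of_equiv _ SemidirectProduct.equivProd.symm
  refine IsCharacter.ind ?_
  obtain ⟨n, ρ, hn, rfl⟩ := hχ
  obtain ⟨α, rfl⟩ := mem_irr_iff_monoidHom.1 hψ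
  refine ⟨n, ⟨⟨fun x => α (x : N ⋊[φ] H).left • ρ ⟨(x : N ⋊[φ] H).right, x.2⟩, ?_⟩, ?_⟩, hn, ?_⟩
  · have h : (⟨(1 : N ⋊[φ] H).right, one_mem _⟩ : inertia φ α) = 1 := rfl
    simp only [OneMemClass.coe_one, SemidirectProduct.one_left, map_one, one_smul]
    rw [← map_one ρ]
    rfl
  · intro x y
    have hx : α (φ (x : N ⋊[φ] H).right (y : N ⋊[φ] H).left) = α (y : N ⋊[φ] H).left := by
      have h := congrFun (show conjChar α _ = α from x.2) (y : N ⋊[φ] H).left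
      rwa [conjChar, conjN_inr] at h
    have hρ : ρ ⟨(x * y : N ⋊[φ] H).right, (x * y).2⟩ =
        ρ ⟨(x : N ⋊[φ] H).right, x.2⟩ * ρ ⟨(y : N ⋊[φ] H).right, y.2⟩ := by
      rw [← map_mul]
      rfl
    simp only [Subgroup.coe_mul] at hρ ⊢
    rw [hρ, SemidirectProduct.mul_left, map_mul, hx, smul_mul_smul_comm]
  · funext x
    simp [Representation.character]

end Semidirect

/-! ### The span of `SCh(ℒ)` -/

section Span

variable {N H : Type*} [CommGroup N] [Finite N] [Group H] [Finite H] {φ : H →* MulAut N}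
  {L : Sublattice (Subgroup H)} {T : ∀ K : L, SupercharacterTheory (K : Subgroup H)}
  {Hsub : (N → ℂ) → L} {S : Set (N → ℂ)}

theorem mem_SCh_iff [Fintype (N ⋊[φ] H)] (hS : IsOrbitReps φ S)
    (hH_le : ∀ ψ ∈ irr N, (Hsub ψ : Subgroup H) ≤ inertia φ ψ) {F : N ⋊[φ] H → ℂ} :
    F ∈ SCh φ L T Hsub S ↔ ∃ ψ ∈ S, ∃ f ∈ extSupercharacters T (Hsub ψ),
      F = rtimesConst φ ψ (Hsub ψ) • conjSum (outer φ ψ f) := by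
  constructor
  · rintro ⟨ψ, hψ, χ, hχ, rfl⟩
    exact ⟨ψ, hψ, _, ⟨χ, hχ, rfl⟩, rtimes_indTo (hS.1 hψ) (hH_le ψ (hS.1 hψ)) χ⟩
  · rintro ⟨ψ, hψ, _, ⟨χ, hχ, rfl⟩, rfl⟩
    exact ⟨ψ, hψ, χ, hχ, (rtimes_indTo (hS.1 hψ) (hH_le ψ (hS.1 hψ)) χ).symm⟩

/-- Distinct members of `SCh(ℒ)` are orthogonal. -/
theorem charInner_eq_zero_of_mem_SCh
    (hL_conj : ∀ K ∈ L, ∀ h : H, conjSubgroup K h ∈ L)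
    (hL_conjChar : ∀ K : L, ∀ h : H, ∀ χ ∈ (T K).supercharacters,
      conjFun χ h ∈ (T ⟨conjSubgroup (K : Subgroup H) h, hL_conj K K.2 h⟩).supercharacters)
    (hH_le : ∀ ψ ∈ irr N, (Hsub ψ : Subgroup H) ≤ inertia φ ψ)
    (hH_conj : ∀ ψ ∈ irr N, ∀ h : H,
      (Hsub (conjChar ψ (SemidirectProduct.inr h : N ⋊[φ] H)) : Subgroup H) =
        conjSubgroup (Hsub ψ : Subgroup H) h)
    (hS : IsOrbitReps φ S) {F F' : N ⋊[φ] H → ℂ} (hF : F ∈ SCh φ L T Hsub S)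
    (hF' : F' ∈ SCh φ L T Hsub S) (hne : F ≠ F') : charInner F F' = 0 := by
  classical
  have : Finite (N ⋊[φ] H) := Finite.of_equiv _ SemidirectProduct.equivProd.symm
  have := Fintype.ofFinite (N ⋊[φ] H)
  rw [mem_SCh_iff hS hH_le] at hF hF'
  obtain ⟨ψ, hψ, f, hf, rfl⟩ := hF
  obtain ⟨ψ', hψ', f', hf', rfl⟩ := hF'
  have hψi := hS.1 hψ
  have hψi' := hS.1 hψ'
  rw [charInner_smul_left, ← charInner_conj_symm, charInner_smul_left, map_mul,
    charInner_conj_symm, charInner_conjSum, Finset.sum_eq_zero, mul_zero, mul_zero, mul_zero]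
  intro g _
  have hconj := outer_conj hψi' (f := f') (fun x hx => by
    obtain ⟨χ, -, rfl⟩ := hf'
    exact zeroExt_of_notMem χ fun h => hx (hH_le ψ' hψi' h)) g
  by_contra h0
  rw [hconj, charInner_outer, charInner_irr hψi (conjChar_mem_irr hψi' _)] at h0
  split_ifs at h0 with hψψ'
  swap
  · simp at h0
  rw [one_mul] at h0
  -- Two conjugate representatives are equal, so `g` stabilizes the character.
  obtain rfl : ψ = ψ' := (hS.2 ψ' hψi').unique ⟨hψ, _, hψψ'⟩
    ⟨hψ', 1, by funext n; simp [conjChar, conjN]⟩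
  have hf'' : (fun y => f' (g.right * y * g.right⁻¹)) ∈ extSupercharacters T (Hsub ψ) :=
    conj_mem_extSupercharacters hL_conj hL_conjChar hf' _ (by
      rw [← hH_conj ψ hψi, ← hψψ'])
  have hff' : f = fun y => f' (g.right * y * g.right⁻¹) := by
    by_contra hne'
    exact h0 (charInner_extSupercharacters hf hf'' hne')
  refine hne ?_
  have : outer φ ψ f = fun x => outer φ ψ f' (g * x * g⁻¹) := by rw [hconj, ← hψψ', ← hff']
  rw [this, conjSum_conj]

/-- The sum of the conjugates of `outer φ ψ f` lies in the span of `SCh(ℒ)` for every `ψ ∈ Irr(N)`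
and every superclass function `f` of a subgroup `K ≤ H_ψ` in `ℒ`: one induces `f` to `H_ψ`, and
moves `ψ` to its representative in `S`. -/
theorem conjSum_outer_mem_span_SCh [Fintype (N ⋊[φ] H)]
    (hL_conj : ∀ K ∈ L, ∀ h : H, conjSubgroup K h ∈ L)
    (hL_ind : ∀ K M : L, (K : Subgroup H) ≤ M → ∀ f : ↥(K : Subgroup H) → ℂ,
      (T K).IsSuperclassFunction f →
        (T M).IsSuperclassFunction (indTo (K : Subgroup H) (M : Subgroup H) f))
    (hL_conjChar : ∀ K : L, ∀ h : H, ∀ χ ∈ (T K).supercharacters,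
      conjFun χ h ∈ (T ⟨conjSubgroup (K : Subgroup H) h, hL_conj K K.2 h⟩).supercharacters)
    (hH_le : ∀ ψ ∈ irr N, (Hsub ψ : Subgroup H) ≤ inertia φ ψ)
    (hH_conj : ∀ ψ ∈ irr N, ∀ h : H,
      (Hsub (conjChar ψ (SemidirectProduct.inr h : N ⋊[φ] H)) : Subgroup H) =
        conjSubgroup (Hsub ψ : Subgroup H) h)
    (hS : IsOrbitReps φ S) {ψ : N → ℂ} (hψ : ψ ∈ irr N) {K : L}
    (hK : (K : Subgroup H) ≤ Hsub ψ) {f : H → ℂ} (hf : f ∈ extSuperclassFunctions T K) :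
    conjSum (outer φ ψ f) ∈ Submodule.span ℂ (SCh φ L T Hsub S) := by
  have hsuper : ∀ f ∈ extSupercharacters T (Hsub ψ),
      conjSum (outer φ ψ f) ∈ Submodule.span ℂ (SCh φ L T Hsub S) := by
    intro f hf
    obtain ⟨ρ, ⟨hρS, g, hρ⟩, -⟩ := hS.2 ψ hψ
    have hconj := outer_conj hψ (f := f) (fun x hx => by
      obtain ⟨χ, -, rfl⟩ := hf
      exact zeroExt_of_notMem χ fun h => hx (hH_le ψ hψ h)) g
    have hρ' : ρ = conjChar ψ (SemidirectProduct.inr g.right : N ⋊[φ] H) :=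
      hρ.trans (conjChar_eq_conjChar_inr ψ g)
    rw [← conjSum_conj _ g, hconj, ← hρ',
      ← Submodule.smul_mem_iff _ (rtimesConst_ne_zero (φ := φ) ρ (Hsub ρ : Subgroup H))]
    refine Submodule.subset_span ((mem_SCh_iff hS hH_le).2 ⟨ρ, hρS, _, ?_, rfl⟩)
    exact conj_mem_extSupercharacters hL_conj hL_conjChar hf _ (by rw [hρ', hH_conj ψ hψ])
  have htop : ∀ f ∈ extSuperclassFunctions T (Hsub ψ),
      conjSum (outer φ ψ f) ∈ Submodule.span ℂ (SCh φ L T Hsub S) := by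
    intro f hf
    rw [extSuperclassFunctions_eq_span] at hf
    have : Submodule.span ℂ (extSupercharacters T (Hsub ψ)) ≤
        (Submodule.span ℂ (SCh φ L T Hsub S)).comap (conjSum ∘ₗ outer φ ψ) :=
      Submodule.span_le.2 hsuper
    exact this hf
  have := Fintype.ofFinite (Hsub ψ : Subgroup H)
  have hsum := htop _ (sum_conj_mem_extSuperclassFunctions hL_ind hK hf)
  have h2 : (fun x => ∑ m : (Hsub ψ : Subgroup H), f (m * x * (m : H)⁻¹)) =
      ∑ m : (Hsub ψ : Subgroup H), fun x => f (m * x * (m : H)⁻¹) := by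
    funext x
    rw [Finset.sum_apply]
  have h3 : ∀ m : (Hsub ψ : Subgroup H),
      conjSum (outer φ ψ fun x => f (m * x * (m : H)⁻¹)) = conjSum (outer φ ψ f) := fun m => by
    have h := outer_conj hψ (fun x hx => eq_zero_of_mem_extSuperclassFunctions hf
      fun h => hx (hH_le ψ hψ (hK h))) (SemidirectProduct.inr (m : H) : N ⋊[φ] H)
    have hm : conjChar ψ (SemidirectProduct.inr (m : H) : N ⋊[φ] H) = ψ := hH_le ψ hψ m.2
    rw [SemidirectProduct.right_inr, hm] at h
    rw [← h, conjSum_conj]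
  rw [h2, map_sum, map_sum, Finset.sum_congr rfl fun m _ => h3 m, Finset.sum_const,
    Finset.card_univ, ← Nat.card_eq_fintype_card, ← Nat.cast_smul_eq_nsmul ℂ] at hsum
  exact (Submodule.smul_mem_iff _ (by exact_mod_cast Nat.card_pos.ne')).1 hsum

end Span

end Supercharacter

/-! ### The supercharacter theory of the semidirect product -/

open Supercharacter

theorem theorem4p2 {N H : Type*} [CommGroup N] [Finite N] [Group H] [Finite H]
    (φ : H →* MulAut N)
    -- the lattice of subgroups of `H`, with its supercharacter theories (L3)
    (L : Sublattice (Subgroup H))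
    (T : ∀ K : L, Supercharacter.SupercharacterTheory (K : Subgroup H))
    -- (L1)
    (hL_top : (⊤ : Subgroup H) ∈ L) (hL_bot : (⊥ : Subgroup H) ∈ L)
    -- (L2), for the conjugates `K^h`, `h ∈ H`
    (hL_conj : ∀ K ∈ L, ∀ h : H, Supercharacter.conjSubgroup K h ∈ L)
    -- (L4): induction, restriction, conjugation
    (hL_ind : ∀ K M : L, (K : Subgroup H) ≤ M → ∀ f : ↥(K : Subgroup H) → ℂ,
      (T K).IsSuperclassFunction f →
        (T M).IsSuperclassFunction (Supercharacter.indTo (K : Subgroup H) (M : Subgroup H) f))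
    (hL_res : ∀ K M : L, ∀ hKM : (K : Subgroup H) ≤ M, ∀ f : ↥(M : Subgroup H) → ℂ,
      (T M).IsSuperclassFunction f →
        (T K).IsSuperclassFunction (fun x => f (Subgroup.inclusion hKM x)))
    (hL_conjChar : ∀ K : L, ∀ h : H, ∀ χ ∈ (T K).supercharacters,
      Supercharacter.conjFun χ h ∈
        (T ⟨Supercharacter.conjSubgroup (K : Subgroup H) h, hL_conj K K.2 h⟩).supercharacters)
    -- the subgroups `H_ψ ∈ ℒ` (only the values at `ψ ∈ Irr(N)` matter)
    (Hsub : (N → ℂ) → L)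
    -- (H1)
    (hH_le : ∀ ψ ∈ Supercharacter.irr N,
      (Hsub ψ : Subgroup H) ≤ Supercharacter.inertia φ ψ)
    (hH_normal : ∀ ψ ∈ Supercharacter.irr N,
      ((Hsub ψ : Subgroup H).subgroupOf (Supercharacter.inertia φ ψ)).Normal)
    -- (H2)
    (hH_conj : ∀ ψ ∈ Supercharacter.irr N, ∀ h : H,
      (Hsub (Supercharacter.conjChar ψ (SemidirectProduct.inr h : N ⋊[φ] H)) : Subgroup H) =
        Supercharacter.conjSubgroup (Hsub ψ : Subgroup H) h)
    -- (H3)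
    (hH_one : (Hsub (fun _ => 1) : Subgroup H) = ⊤)
    -- (H4)
    (hH_mul : ∀ ψ₁ ∈ Supercharacter.irr N, ∀ ψ₂ ∈ Supercharacter.irr N,
      (Hsub ψ₁ : Subgroup H) ⊓ (Hsub ψ₂ : Subgroup H) ≤ Hsub (fun n => ψ₁ n * ψ₂ n))
    -- orbit representatives
    (S : Set (N → ℂ)) (hS : Supercharacter.IsOrbitReps φ S) :
    ∃ 𝒯 : Supercharacter.SupercharacterTheory (N ⋊[φ] H),
      𝒯.supercharacters = Supercharacter.SCh φ L T Hsub S := by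
  classical
  have : Finite (N ⋊[φ] H) := Finite.of_equiv _ SemidirectProduct.equivProd.symm
  have := Fintype.ofFinite (N ⋊[φ] H)
  have hspan : ∀ ψ ∈ irr N, ∀ K : L, (K : Subgroup H) ≤ Hsub ψ →
      ∀ f ∈ extSuperclassFunctions T K,
      conjSum (outer φ ψ f) ∈ Submodule.span ℂ (SCh φ L T Hsub S) :=
    fun ψ hψ K hK f hf =>
      conjSum_outer_mem_span_SCh hL_conj hL_ind hL_conjChar hH_le hH_conj hS hψ hK hf
  have hcard : (Nat.card (N ⋊[φ] H) : ℂ) ≠ 0 := by exact_mod_cast Nat.card_pos.ne'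
  refine exists_supercharacterTheory _ ?_ ?_ ?_ ?_ ?_
  · rintro _ ⟨ψ, hψ, χ, hχ, rfl⟩
    exact IsCharacter.rtimes (hS.1 hψ) (IsCharacter.indTo ((T _).isCharacter χ hχ))
  · intro F hF F' hF' hne
    exact charInner_eq_zero_of_mem_SCh hL_conj hL_conjChar hH_le hH_conj hS hF hF' hne
  · -- The constant function `1` comes from `ψ = 1`, for which `H_ψ = H`.
    have h1 : (1 : H → ℂ) ∈ extSuperclassFunctions T ⟨⊤, hL_top⟩ := by
      refine ⟨1, fun _ _ _ _ _ _ => rfl, ?_⟩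
      funext x
      exact zeroExt_of_mem _ (Subgroup.mem_top x)
    have h2 := hspan _ one_mem_irr ⟨⊤, hL_top⟩ hH_one.ge _ h1
    have h3 : conjSum (outer φ (fun _ => 1) 1) = (Nat.card (N ⋊[φ] H) : ℂ) • 1 := by
      funext x
      simp [conjSum_apply, outer_apply, Nat.card_eq_fintype_card]
    rw [h3] at h2
    exact (Submodule.smul_mem_iff _ hcard).1 h2
  · -- By Mackey's formula a product is a sum of terms for `H_{ψ^g} ∩ H_{ψ'} ≤ H_{ψ^g ψ'}`.
    intro F hF F' hF'
    rw [mem_SCh_iff hS hH_le] at hF hF'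
    obtain ⟨ψ, hψ, f, hf, rfl⟩ := hF
    obtain ⟨ψ', hψ', f', hf', rfl⟩ := hF'
    have hψi := hS.1 hψ
    have hψi' := hS.1 hψ'
    replace hf : f ∈ extSuperclassFunctions T (Hsub ψ) := by
      rw [extSuperclassFunctions_eq_span]
      exact Submodule.subset_span hf
    replace hf' : f' ∈ extSuperclassFunctions T (Hsub ψ') := by
      rw [extSuperclassFunctions_eq_span]
      exact Submodule.subset_span hf'
    rw [smul_mul_smul_comm, conjSum_mul_conjSum]
    refine Submodule.smul_mem _ _ (Submodule.sum_mem _ fun g _ => ?_)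
    have hconj := outer_conj hψi (fun x hx => eq_zero_of_mem_extSuperclassFunctions hf
      fun h => hx (hH_le ψ hψi h)) g
    have hmul : (fun x => outer φ ψ f (g * x * g⁻¹) * outer φ ψ' f' x) =
        outer φ (fun n => conjChar ψ (SemidirectProduct.inr g.right : N ⋊[φ] H) n * ψ' n)
          ((fun y => f (g.right * y * g.right⁻¹)) * f') := by
      funext x
      rw [congrFun hconj x]
      simp only [outer_apply, Pi.mul_apply]
      ring
    have hψg := conjChar_mem_irr (φ := φ) hψi g.right
    rw [hmul]
    refine hspan _ (mul_mem_irr hψg hψi')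
      (Hsub (conjChar ψ (SemidirectProduct.inr g.right : N ⋊[φ] H)) ⊓ Hsub ψ')
      (hH_mul _ hψg _ hψi') _ (mul_mem_extSuperclassFunctions hL_res ?_ hf')
    exact conj_mem_extSuperclassFunctions hL_conj hL_conjChar hf _ (hH_conj ψ hψi _)
  · -- The regular character comes from the functions `outer φ ψ 1_{1}`, with `{1} ∈ ℒ`.
    have h1 : (Pi.single 1 1 : H → ℂ) ∈ extSuperclassFunctions T ⟨⊥, hL_bot⟩ := by
      refine ⟨1, fun _ _ _ _ _ _ => rfl, ?_⟩
      funext x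
      by_cases hx : x = 1
      · subst hx
        rw [zeroExt_of_mem _ (Subgroup.mem_bot.2 rfl)]
        simp
      · rw [zeroExt_of_notMem _ fun h => hx (Subgroup.mem_bot.1 h)]
        simp [hx]
    obtain ⟨ι, _, ψ, hψ, hsum⟩ := exists_sum_irr_eq_single N
    have h2 : ∑ i, conjSum (outer φ (ψ i) (Pi.single 1 1)) ∈
        Submodule.span ℂ (SCh φ L T Hsub S) :=
      Submodule.sum_mem _ fun i _ => hspan _ (hψ i) ⟨⊥, hL_bot⟩ bot_le _ h1
    have h3 : ∑ i, outer φ (ψ i) (Pi.single 1 1) =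
        (Nat.card N : ℂ) • (Pi.single 1 1 : N ⋊[φ] H → ℂ) := by
      funext x
      simp only [Finset.sum_apply, outer_apply, ← Finset.sum_mul, hsum, Pi.smul_apply, smul_eq_mul]
      by_cases hx : x = 1
      · simp [hx]
      · rw [Pi.single_eq_of_ne hx, mul_zero]
        by_cases hr : x.right = 1
        · have hl : x.left ≠ 1 := fun hl => hx (SemidirectProduct.ext hl hr)
          rw [if_neg hl, zero_mul]
        · rw [Pi.single_eq_of_ne hr, mul_zero]
    have h4 : conjSum (Pi.single 1 1 : N ⋊[φ] H → ℂ) =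
        (Nat.card (N ⋊[φ] H) : ℂ) • (Pi.single 1 1 : N ⋊[φ] H → ℂ) := by
      funext x
      simp [conjSum_apply, Pi.single_apply, Nat.card_eq_fintype_card]
    rw [← map_sum, h3, map_smul, h4, smul_smul] at h2
    exact (Submodule.smul_mem_iff _
      (mul_ne_zero (by exact_mod_cast Nat.card_pos.ne') hcard)).1 h2
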